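/- Let $k,a,d,s$ be integers with $k\ge 2$, $1\le a\le k$, $1\le d\le k$, $0\le s\le d-1$. An overpartition is a partition in which the first occurrence of each part may be overlined. For a partition let $f_i$ be the number of occurrences of $i$. For an overpartition let $f_i$ and $f_{\overline i}\in\{0,1\}$ be the numbers of occurrences of the non-overlined part $i$ and of the overlined part $\overline i$, and let $\rho(i)=\sum_{j=1}^{i}(-1)^j f_{\overline j}$. All the counters below are $0$ for negative $n$; for $n\ge 0$ they are defined as follows. * For $b\ge1$ with $2b\neq 2k+2-d$, ${}_dA_{k,b}(n)$ is the number of partitions of $n$ into parts $\not\equiv 0,\pm b \pmod{2k+2-d}$. It is left undefined if $2b=2k+2-d$. * For $1\le b\le k$, ${}_d\overline A_{k,b}(n)$ is the number of overpartitions of $n$ whose non-overlined parts are $\not\equiv 0,\pm b\pmod{2k+1-d}$ if $2b\ne 2k+1-d$, and the number of overpartitions of $n$ all of whose parts (overlined or not) are $\not\equiv 0\pmod{k+(1-d)/2}$ if $2b=2k+1-d$. * ${}_dB^s_{k,a}(n)$ is the number of partitions of $n$ such that $f_1<a$, $f_i+f_{i+1}<k$ for all $i\ge1$, and, for all $i\ge1$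 and $\delta=1,\dots,d-1$, if $f_i+f_{i+1}=k-\delta$ then $a+s-1-f_{\rm odd}$ is congruent modulo $d$ to one of $0,1,\dots,\delta-1$; here $f_{\rm odd}=f_i$ if $i$ is odd and $f_{\rm odd}=f_{i+1}$ if $i$ is even. * ${}_d\overline B^s_{k,a}(n)$ is the number of overpartitions of $n$ such that $f_1<a$, $f_i+f_{\overline i}+f_{i+1}<k$ for all $i\ge1$, and, for all $i\ge1$ and $\delta=1,\dots,d-1$, if $f_i+f_{\overline i}+f_{i+1}=k-\delta$ then $a+s-1-f_{\rm odd}-\rho(i)$ is congruent modulo $d$ to one of $0,1,\dots,\delta-1$; here $f_{\rm odd}=f_i+f_{\overline i}$ if $i$ is odd and $f_{\rm odd}=f_{i+1}$ if $i$ is even. Then for every integer $n\ge0$ the following hold. 1. If $s=0$, $2a\equiv 2(k+1)\equiv 0\pmod d$ and $2a\ne 2k+2-d$, then ${}_dA_{k,a}(n)={}_dB^0_{k,a}(n)$. 2. If $s=0$ and $d\in\{1,2\}$, then ${}_d\overline A_{k,a}(n)={}_d\overline B^0_{k,a}(n)$. 3. If $s\ne0$, $2(a+s)\equiv 2(k+1)\equiv0\pmod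 d$, $2(a+s)\neq 2k+2-d$ and $2(a+s)\ne 2k+2+d$, then ${}_dB^s_{k,a}(n)-{}_dB^s_{k,a}(n-d)$ equals * ${}_dA_{k,a+s}(n)-{}_dA_{k,a+s}(n-(d-s))+{}_dA_{k,a+s-d}(n-(d-s))-{}_dA_{k,a+s-d}(n-d)$ if $d<a+s$; * ${}_dA_{k,a+s}(n)-{}_dA_{k,a+s}(n-(d-s))$ if $d=a+s$; * ${}_dA_{k,a+s}(n)-{}_dA_{k,a+s}(n-(d-s))+{}_dA_{k,d-a-s}(n-(a+s))-{}_dA_{k,d-a-s}(n-a)$ if $d>a+s$. 4. If $s\ne0$, $d\in\{1,2\}$ (so that $d=2$, $s=1$) and $a+s\le k$, then ${}_d\overline B^s_{k,a}(n)-{}_d\overline B^s_{k,a}(n-d)$ equals * ${}_d\overline A_{k,a+s}(n)-{}_d\overline A_{k,a+s}(n-(d-s))+{}_d\overline A_{k,a+s-d}(n-(d-s))-{}_d\overline A_{k,a+s-d}(n-d)$ if $d<a+s$; * ${}_d\overline A_{k,a+s}(n)-{}_d\overline A_{k,a+s}(n-(d-s))$ if $d=a+s$. -/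

import Mathlib

namespace GordonModD

/-- An overpartition of `n`: a finite multiset of non-overlined parts, together with a finite set
of overlined parts (only the first occurrence of a part may be overlined, so each overlined part
occurs at most once), all parts being positive, with total sum `n`. -/
@[ext]
structure Overpartition (n : ℕ) where
  /-- the non-overlined parts -/
  plain : Multiset ℕ
  /-- the overlined parts -/
  overlined : Finset ℕ
  plain_pos : ∀ i ∈ plain, 0 < i
  overlined_pos : ∀ i ∈ overlined, 0 < i
  sum_eq : plain.sum + ∑ i ∈ overlined, i = n

/-- There are finitely many overpartitions of `n`, so that `Nat.card` below is a genuine count. -/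
instance (n : ℕ) : Finite (Overpartition n) := by
  let g : Overpartition n → n.Partition × Finset (Fin (n + 1)) := fun p =>
    (⟨p.plain + p.overlined.val, by
        intro i hi
        rcases Multiset.mem_add.1 hi with h | h
        · exact p.plain_pos i h
        · exact p.overlined_pos i h, by
        have h := p.sum_eq
        have h' : ∑ i ∈ p.overlined, i = p.overlined.val.sum := by
          rw [Finset.sum, Multiset.map_id']
        rw [h'] at h
        rw [Multiset.sum_add]
        exact h⟩,
      Finset.univ.filter fun j : Fin (n + 1) => (j : ℕ) ∈ p.overlined)
  refine Finite.of_injective g ?_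
  intro p q h
  have h1 : p.plain + p.overlined.val = q.plain + q.overlined.val :=
    congrArg (fun x => Nat.Partition.parts x.1) h
  have h2 := congrArg Prod.snd h
  have le : ∀ (r : Overpartition n) (i : ℕ), i ∈ r.overlined → i < n + 1 := by
    intro r i hi
    have h3 : i ≤ ∑ j ∈ r.overlined, j :=
      Finset.single_le_sum (f := fun j : ℕ => j) (fun _ _ => Nat.zero_le _) hi
    have h4 := r.sum_eq
    omega
  have key : ∀ i (hi : i < n + 1), i ∈ p.overlined ↔ i ∈ q.overlined := by
    intro i hi
    have h3 := Finset.ext_iff.1 h2 ⟨i, hi⟩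
    simpa [g] using h3
  have ho : p.overlined = q.overlined := by
    ext i
    exact ⟨fun hi => (key i (le p i hi)).1 hi, fun hi => (key i (le q i hi)).2 hi⟩
  rw [ho] at h1
  exact Overpartition.ext (add_right_cancel h1) ho

/-- `f_i`, the number of occurrences of the part `i` in a partition. -/
def freq {n : ℕ} (p : n.Partition) (i : ℕ) : ℕ := p.parts.count i

namespace Overpartition

/-- `f_i`, the number of occurrences of the non-overlined part `i`. -/
def freq {n : ℕ} (p : Overpartition n) (i : ℕ) : ℕ := p.plain.count i

/-- The number (`0` or `1`) of occurrences of the overlined part `i`. -/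
def freqOver {n : ℕ} (p : Overpartition n) (i : ℕ) : ℕ := if i ∈ p.overlined then 1 else 0

/-- The signed number of overlined parts that are at most `i`. -/
def rho {n : ℕ} (p : Overpartition n) (i : ℕ) : ℤ :=
  ∑ j ∈ Finset.Icc 1 i, (-1) ^ j * (p.freqOver j : ℤ)

/-- `f_odd` for the pair of consecutive numbers `i`, `i + 1`. -/
def freqOdd {n : ℕ} (p : Overpartition n) (i : ℕ) : ℕ :=
  if Odd i then p.freq i + p.freqOver i else p.freq (i + 1)

end Overpartition

/-- `f_odd` for the pair of consecutive numbers `i`, `i + 1`. -/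
def freqOdd {n : ℕ} (p : n.Partition) (i : ℕ) : ℕ :=
  if Odd i then freq p i else freq p (i + 1)

/-- `x ≡ 0, 1, …, δ - 1 (mod d)`. -/
def ResidueBelow (d : ℕ) (x : ℤ) (δ : ℕ) : Prop := ∃ r : ℕ, r < δ ∧ x ≡ (r : ℤ) [ZMOD d]

/-- `i ≢ 0, ±a (mod M)`. -/
def AvoidsResidues (M a i : ℕ) : Prop :=
  ¬ (i : ℤ) ≡ 0 [ZMOD M] ∧ ¬ (i : ℤ) ≡ (a : ℤ) [ZMOD M] ∧ ¬ (i : ℤ) ≡ -(a : ℤ) [ZMOD M]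

/-- The number of partitions of `n` into parts `≢ 0, ±a (mod 2k + 2 - d)`
(to be used only for `2a ≠ 2k + 2 - d`). -/
noncomputable def countA (d k a n : ℕ) : ℕ :=
  Nat.card {p : n.Partition // ∀ i ∈ p.parts, AvoidsResidues (2 * k + 2 - d) a i}

/-- The number of overpartitions of `n` whose non-overlined parts are
`≢ 0, ±a (mod 2k + 1 - d)`, if `2a ≠ 2k + 1 - d`; the number of overpartitions of `n` all of whose
parts are `≢ 0 (mod k + (1 - d)/2)`, if `2a = 2k + 1 - d` (the division is then exact). -/
noncomputable def countAOver (d k a n : ℕ) : ℕ :=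
  if 2 * a = 2 * k + 1 - d then
    Nat.card {p : Overpartition n // (∀ i ∈ p.plain, ¬ i ≡ 0 [MOD (2 * k + 1 - d) / 2]) ∧
      ∀ i ∈ p.overlined, ¬ i ≡ 0 [MOD (2 * k + 1 - d) / 2]}
  else
    Nat.card {p : Overpartition n // ∀ i ∈ p.plain, AvoidsResidues (2 * k + 1 - d) a i}

/-- The multiplicity conditions for partitions. -/
def CondB (d s k a : ℕ) {n : ℕ} (p : n.Partition) : Prop :=
  freq p 1 < a ∧
  ∀ i : ℕ, 1 ≤ i →
    freq p i + freq p (i + 1) < k ∧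
    ∀ δ : ℕ, 1 ≤ δ → δ ≤ d - 1 → freq p i + freq p (i + 1) = k - δ →
      ResidueBelow d ((a : ℤ) + s - 1 - freqOdd p i) δ

/-- The multiplicity conditions for overpartitions. -/
def CondBOver (d s k a : ℕ) {n : ℕ} (p : Overpartition n) : Prop :=
  p.freq 1 < a ∧
  ∀ i : ℕ, 1 ≤ i →
    p.freq i + p.freqOver i + p.freq (i + 1) < k ∧
    ∀ δ : ℕ, 1 ≤ δ → δ ≤ d - 1 → p.freq i + p.freqOver i + p.freq (i + 1) = k - δ →
      ResidueBelow d ((a : ℤ) + s - 1 - p.freqOdd i - p.rho i) δ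

/-- The number of partitions of `n` satisfying the multiplicity conditions. -/
noncomputable def countB (d s k a n : ℕ) : ℕ :=
  Nat.card {p : n.Partition // CondB d s k a p}

/-- The number of overpartitions of `n` satisfying the multiplicity conditions. -/
noncomputable def countBOver (d s k a n : ℕ) : ℕ :=
  Nat.card {p : Overpartition n // CondBOver d s k a p}

/-- A counter at an integer argument, with value `0` at negative arguments. -/
def atInt (f : ℕ → ℕ) (n : ℤ) : ℤ := if 0 ≤ n then (f n.toNat : ℤ) else 0

end GordonModD

/-!
Partitions are treated as overpartitions without overlined parts, and a parameter `e ≤ 1` bounds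
the multiplicity of overlined parts, so that one argument serves `A`, `B` (`e = 0`) and their
overlined versions (`e = 1`). Generating functions are computed in an arbitrary commutative ring
with an element `q` such that `q ^ K = 0`: all sums and products are then finite, and
`1 - q ^ i`, `1 + q ^ i` are units for `i > 0`. The choice `ℤ⟦X⟧ ⧸ (X ^ K)` recovers the
coefficients (`atInt_relation`).

The conditions defining `B` say that `f_i + f_{\bar i} + f_{i+1} + r < k`, where `r` is the least
nonnegative residue of `a + s - 1 - f_odd - ρ(i)` modulo `d` (`residue_condition_iff`). This is
stable under removal of the smallest part (`residue_reflect`, `admissible_succ`). Let `B_a(x)`, for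
`x = q ^ N`, be the generating function for parts larger than `N`, bound `a` and `s = 0`. The
multiplicities `j` of the part `N + 1` in a window of length at most `d` all leave the same bound
for the next multiplicity (`admSeries_sub`); with `y = x q` this gives
`(1 - y) (B_a(x) - B_{a-d}(x)) = y^{a-d} (1 - y^d) (B_{k+1-a}(y) + e y B_{k-a}(y))`.
The class of all `a` with `d ∣ 2 a` is closed under this recursion, as `d ∣ 2 (k + 1)` and
`d ∣ 2 e`, and its only member with `0 < a < d` is `a = d / 2`, for which `B_{a-d} = -y^{-a} B_a` plays the role of the missing term.
Up to the factor `∏ (1 + e qⁱ) / (1 - qⁱ)` the same recursion is solved by an explicit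
series of Andrews type, `thetaSeries` (`thetaSeries_sub`, `thetaSeries_half`), and the recursion
together with the value `1` for large `N` determines the solution (`admSeries_mul_prod`).

At `x = 1` the series is a theta series, which the Jacobi triple product (`jacobi_triple_product`,
from MacMahon's finite form `prod_mul_prod_eq_sum`) turns into the product over the parts forbidden
in `A` (`thetaSeries_mul_prod_avoids`); if `2 a` equals the modulus, Euler's identity
`∏ (1 + zʲ) (1 - z²ʲ⁻¹) = 1` brings the product into the shape required for overpartitions
(`thetaSeries_symm`). This settles `s = 0`. For `s ≠ 0`, comparing two windows that leave the same
bound gives `(1 - q^d) Bˢ_a = (1 - q^{d-s}) B_{a+s} + (q^{d-s} - q^d) B_{a+s-d}` if `a + s ≥ d`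
(`admSeries_shift`), and `(1 - q^{a+s}) Bˢ_a = (1 - q^a) B_{a+s}` in the remaining case
`d = 2 (a + s)` (`admSeries_shift_half`). The divisibility hypotheses force `a + s ≤ k + 1`, the
range in which the product formulas hold.
-/

namespace GordonModD

/-! ### Multiplicity sequences -/

/-- `f_odd` for the pair of parts `i + 1`, `i + 2` of a multiplicity sequence: `u i` lists the
multiplicities of the non-overlined and of the overlined part `i + 1`. -/
def seqOdd (u : ℕ → ℕ × ℕ) (i : ℕ) : ℕ :=
  if Even i then (u i).1 + (u i).2 else (u (i + 1)).1

/-- The signed number of overlined parts that are at most `i + 1`. -/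
def seqRho (u : ℕ → ℕ × ℕ) (i : ℕ) : ℤ :=
  ∑ j ∈ Finset.range (i + 1), (-1) ^ (j + 1) * ((u j).2 : ℤ)

/-- The multiplicity conditions with bound `a` on the part `1` and residue parameter `c`
(which is `a + s - 1` in `CondB`); the congruence condition is encoded by adding the least
nonnegative residue to the multiplicities. -/
def Admissible (d k a : ℕ) (c : ℤ) (u : ℕ → ℕ × ℕ) : Prop :=
  (u 0).1 < a ∧ ∀ i, (u i).1 + (u i).2 + (u (i + 1)).1 +
    ((c - seqOdd u i - seqRho u i) % d).toNat < k

theorem residueBelow_iff {d : ℕ} {y : ℤ} {δ : ℕ} (hδ : δ ≤ d - 1) (hd : 0 < d) :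
    ResidueBelow d y δ ↔ (y % d).toNat < δ := by
  have h0 := Int.emod_nonneg y (by omega : (d : ℤ) ≠ 0)
  constructor
  · rintro ⟨r, hr, h⟩
    rw [h, Int.emod_eq_of_lt (by omega) (by omega)]
    simpa using hr
  · intro h
    refine ⟨_, h, ?_⟩
    rw [Int.toNat_of_nonneg h0]
    exact (Int.mod_modEq _ _).symm

/-- The congruence conditions for all `δ` amount to one inequality: the sum `S` of the
multiplicities leaves room for the least nonnegative residue of `y`. -/
theorem residue_condition_iff {d k : ℕ} (hd : 0 < d) (S : ℕ) (y : ℤ) :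
    (S < k ∧ ∀ δ : ℕ, 1 ≤ δ → δ ≤ d - 1 → S = k - δ → ResidueBelow d y δ) ↔
      S + (y % d).toNat < k := by
  have h0 := Int.emod_nonneg y (by omega : (d : ℤ) ≠ 0)
  have h1 := Int.emod_lt_of_pos y (by omega : (0 : ℤ) < d)
  constructor
  · rintro ⟨h, H⟩
    by_cases hS : k - S ≤ d - 1
    · have := (residueBelow_iff hS hd).1 (H (k - S) (by omega) hS (by omega))
      omega
    · omega
  · intro h
    refine ⟨by omega, fun δ _ h3 h4 => (residueBelow_iff h3 hd).2 ?_⟩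
    omega

/-- The residue condition is symmetric under exchanging the two members of a pair of consecutive
parts; this is what makes removal of the smallest part compatible with the conditions. -/
theorem residue_reflect {d k : ℕ} (hd : 0 < d) (S : ℕ) (y : ℤ) :
    S + (y % d).toNat < k ↔ S + (((k : ℤ) - 1 - S - y) % d).toNat < k := by
  have key : ∀ (t : ℕ) (y : ℤ), (y % d).toNat ≤ t → (((t : ℤ) - y) % d).toNat ≤ t := by
    intro t y h
    have h0 := Int.emod_nonneg y (by omega : (d : ℤ) ≠ 0)
    have h2 := Int.emod_lt_of_pos ((t : ℤ) - y) (by omega : (0 : ℤ) < d)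
    by_cases ht : d ≤ t
    · omega
    · have h3 : ((t : ℤ) - y) % d = (t - y % d) % d := by rw [Int.sub_emod_emod]
      rw [h3, Int.emod_eq_of_lt (by omega) (by omega)]
      omega
  by_cases hS : S < k
  · obtain ⟨t, rfl⟩ : ∃ t, k = S + t + 1 := ⟨k - S - 1, by omega⟩
    have h1 := key t y
    have h2 := key t (t - y)
    rw [sub_sub_cancel] at h2
    have h3 : ((S + t + 1 : ℕ) : ℤ) - 1 - S - y = t - y := by push_cast; ring
    rw [h3]
    constructor <;> intro h <;> [have := h1 (by omega); have := h2 (by omega)] <;> omega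
  · omega

theorem seqRho_succ (u : ℕ → ℕ × ℕ) (i : ℕ) :
    seqRho u (i + 1) = -((u 0).2 : ℤ) - seqRho (fun j => u (j + 1)) i := by
  unfold seqRho
  rw [Finset.sum_range_succ', ← sub_eq_zero]
  have : ∀ j ∈ Finset.range (i + 1), (-1 : ℤ) ^ (j + 1 + 1) * ((u (j + 1)).2 : ℤ) =
      -((-1) ^ (j + 1) * ((u (j + 1)).2 : ℤ)) := fun j _ => by ring
  rw [Finset.sum_congr rfl this, Finset.sum_neg_distrib]
  ring

theorem seqOdd_succ (u : ℕ → ℕ × ℕ) (i : ℕ) :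
    seqOdd u (i + 1) + seqOdd (fun j => u (j + 1)) i =
      (u (i + 1)).1 + (u (i + 1)).2 + (u (i + 2)).1 := by
  unfold seqOdd
  by_cases h : Even i
  · rw [if_pos h, if_neg (by simpa [Nat.even_add_one] using h)]
    ring
  · simp [h, Nat.even_add_one]

/-- Removal of the part `1`. -/
theorem admissible_succ {d k : ℕ} (hd : 0 < d) (a : ℕ) (c : ℤ) (u : ℕ → ℕ × ℕ) :
    Admissible d k a c u ↔ (u 0).1 < a ∧
      Admissible d k (k - (u 0).1 - (u 0).2 - ((c - (u 0).1) % d).toNat) (k - 1 - c - (u 0).2)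
        (fun j => u (j + 1)) := by
  unfold Admissible
  refine and_congr_right fun _ => ?_
  rw [← Nat.and_forall_add_one]
  refine and_congr ?_ (forall_congr' fun i => ?_)
  · have : c - seqOdd u 0 - seqRho u 0 = c - (u 0).1 := by
      simp [seqOdd, seqRho]
      ring
    rw [this]
    simp only [zero_add]
    omega
  · rw [residue_reflect hd]
    have h1 := seqRho_succ u i
    have h2 := seqOdd_succ u i
    have h3 : (k : ℤ) - 1 - (((u (i + 1)).1 + (u (i + 1)).2 + (u (i + 1 + 1)).1 : ℕ) : ℤ) -
        (c - seqOdd u (i + 1) - seqRho u (i + 1)) =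
        k - 1 - c - (u 0).2 - seqOdd (fun j => u (j + 1)) i - seqRho (fun j => u (j + 1)) i := by
      rw [← h2, h1]
      push_cast
      ring
    rw [h3]

/-- The multiplicity sequence of an overpartition. -/
def Overpartition.seq {n : ℕ} (p : Overpartition n) (i : ℕ) : ℕ × ℕ :=
  (p.freq (i + 1), p.freqOver (i + 1))

theorem condBOver_iff {d s k a n : ℕ} (hd : 0 < d) (p : Overpartition n) :
    CondBOver d s k a p ↔ Admissible d k a ((a : ℤ) + s - 1) p.seq := by
  unfold CondBOver Admissible
  refine and_congr Iff.rfl ?_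
  have hrho : ∀ i, p.rho (i + 1) = seqRho p.seq i := by
    intro i
    unfold Overpartition.rho seqRho
    rw [Finset.range_eq_Ico]
    exact (Finset.sum_Ico_add' (fun j => (-1 : ℤ) ^ j * (p.freqOver j : ℤ)) 0 (i + 1) 1).symm
  have hodd : ∀ i, p.freqOdd (i + 1) = seqOdd p.seq i := by
    intro i
    unfold Overpartition.freqOdd seqOdd
    simp only [Nat.odd_add_one, Nat.not_odd_iff_even]
    rfl
  constructor
  · intro h i
    have := (residue_condition_iff hd _ _).1 (h (i + 1) (by omega))
    rwa [hrho, hodd] at this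
  · intro h i hi
    obtain ⟨i, rfl⟩ : ∃ j, i = j + 1 := ⟨i - 1, by omega⟩
    refine (residue_condition_iff hd _ _).2 ?_
    rw [hrho, hodd]
    exact h i

/-! ### Generating functions of admissible sequences -/

/-- Extension by zero of a finite multiplicity sequence. -/
def extend {L B e : ℕ} (g : Fin L → Fin B × Fin (e + 1)) (i : ℕ) : ℕ × ℕ :=
  if h : i < L then ((g ⟨i, h⟩).1, (g ⟨i, h⟩).2) else (0, 0)

/-- The sum of the parts, when the entries of the sequence are the multiplicities of
`N + 1`, `N + 2`, …, `N + L`. -/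
def weight {L B e : ℕ} (N : ℕ) (g : Fin L → Fin B × Fin (e + 1)) : ℕ :=
  ∑ i, (N + 1 + i) * ((g i).1 + (g i).2)

/-- The generating function of the admissible overpartitions with parts in `N + 1, …, N + L`,
without overlined parts if `e = 0`, where the part `N + 1` plays the role of the part `1`. -/
def admSeries {R : Type*} [CommRing R] (q : R) (d k e : ℕ) : ℕ → ℕ → ℕ → ℤ → R
  | 0, _, a, _ => if 0 < a then 1 else 0
  | L + 1, N, a, c => ∑ j ∈ Finset.range a, ∑ v ∈ Finset.range (e + 1),
      (q ^ (N + 1)) ^ (j + v) *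
        admSeries q d k e L (N + 1) (k - j - v - ((c - j) % d).toNat) (k - 1 - c - v)

variable {R : Type*} [CommRing R] (q : R)

theorem extend_cons_zero {L B e : ℕ} (x : Fin B × Fin (e + 1)) (g : Fin L → Fin B × Fin (e + 1)) :
    extend (Fin.cons (α := fun _ => Fin B × Fin (e + 1)) x g) 0 = ((x.1 : ℕ), (x.2 : ℕ)) := by
  simp [extend]

theorem extend_cons_succ {L B e : ℕ} (x : Fin B × Fin (e + 1)) (g : Fin L → Fin B × Fin (e + 1))
    (i : ℕ) : extend (Fin.cons (α := fun _ => Fin B × Fin (e + 1)) x g) (i + 1) = extend g i := by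
  unfold extend
  by_cases h : i < L
  · have h' : i + 1 < L + 1 := by omega
    rw [dif_pos h, dif_pos h']
    rfl
  · have h' : ¬ i + 1 < L + 1 := by omega
    rw [dif_neg h, dif_neg h']

theorem weight_cons {L B e : ℕ} (N : ℕ) (x : Fin B × Fin (e + 1))
    (g : Fin L → Fin B × Fin (e + 1)) :
    weight N (Fin.cons (α := fun _ => Fin B × Fin (e + 1)) x g) =
      (N + 1) * (x.1 + x.2) + weight (N + 1) g := by
  unfold weight
  rw [Fin.sum_univ_succ]
  simp only [Fin.cons_zero, Fin.cons_succ, Fin.val_zero, Fin.val_succ]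
  congr 1
  refine Finset.sum_congr rfl fun i _ => ?_
  congr 1
  omega

open Classical in
/-- The recursion defining `admSeries` counts admissible sequences. The bound `B` only makes the sum
finite: admissibility keeps all multiplicities below `max a k`. -/
theorem sum_admissible_eq_admSeries {d k e B : ℕ} (hd : 0 < d) (hdk : d ≤ k) (hB : k ≤ B)
    (L : ℕ) : ∀ (N a : ℕ) (c : ℤ), a ≤ B →
    (∑ g : Fin L → Fin B × Fin (e + 1),
      if Admissible d k a c (extend g) then q ^ weight N g else 0) =
      admSeries q d k e L N a c := by
  induction L with
  | zero =>
    intro N a c _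
    have h : ∀ g : Fin 0 → Fin B × Fin (e + 1), Admissible d k a c (extend g) ↔ 0 < a := by
      intro g
      have h0 : extend g = fun _ => (0, 0) := by
        funext i
        simp [extend]
      rw [h0]
      unfold Admissible
      simp only [add_zero, zero_add, and_iff_left_iff_imp]
      intro _ i
      have h1 := Int.emod_lt_of_pos (c - seqOdd (fun _ => (0, 0)) i - seqRho (fun _ => (0, 0)) i)
        (by omega : (0 : ℤ) < d)
      omega
    simp [h, admSeries, weight]
  | succ L ih =>
    intro N a c ha
    rw [← Equiv.sum_comp (Fin.consEquiv fun _ : Fin (L + 1) => Fin B × Fin (e + 1)),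
      Fintype.sum_prod_type, Fintype.sum_prod_type, admSeries]
    have hr : ∀ F : ℕ → R, ∑ j ∈ Finset.range a, F j =
        ∑ j : Fin B, if (j : ℕ) < a then F j else 0 := by
      intro F
      rw [← Finset.sum_range (fun j => if j < a then F j else 0), ← Finset.sum_filter]
      congr 1
      ext j
      simp only [Finset.mem_range, Finset.mem_filter]
      omega
    rw [hr]
    refine Finset.sum_congr rfl fun x _ => ?_
    rw [Finset.sum_range]
    split_ifs with hx
    · refine Finset.sum_congr rfl fun v _ => ?_
      rw [← ih _ _ _ (by omega), Finset.mul_sum]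
      refine Finset.sum_congr rfl fun g _ => ?_
      change (if Admissible d k a c (extend (Fin.cons (x, v) g)) then
        q ^ weight N (Fin.cons (x, v) g) else 0) = _
      rw [admissible_succ hd, extend_cons_zero, weight_cons]
      simp only [extend_cons_succ, hx, true_and, mul_ite, mul_zero, pow_add, pow_mul]
    · refine Finset.sum_eq_zero fun v _ => Finset.sum_eq_zero fun g _ => ?_
      change (if Admissible d k a c (extend (Fin.cons (x, v) g)) then
        q ^ weight N (Fin.cons (x, v) g) else 0) = _
      rw [admissible_succ hd, extend_cons_zero, if_neg fun h => hx h.1]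

theorem admSeries_congr {d k e : ℕ} (L : ℕ) : ∀ (N a : ℕ) {c c' : ℤ}, c ≡ c' [ZMOD d] →
    admSeries q d k e L N a c = admSeries q d k e L N a c' := by
  induction L with
  | zero => intros; rfl
  | succ L ih =>
    intro N a c c' h
    unfold admSeries
    refine Finset.sum_congr rfl fun j _ => Finset.sum_congr rfl fun v _ => ?_
    have h1 : (c - j) % d = (c' - j) % d := h.sub_right _
    rw [h1, ih _ _ ((h.sub_left (k - 1)).sub_right v)]

theorem admSeries_zero {d k e : ℕ} (L N : ℕ) (c : ℤ) : admSeries q d k e L N 0 c = 0 := by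
  cases L <;> simp [admSeries]

/-- Removal of the smallest possible part `N + 1` from the sequences in which its multiplicity
lies in `[a₁, a₂)`: all of them leave the same bound for the next multiplicity. -/
theorem admSeries_sub {d k e : ℕ} (L N : ℕ) {a₁ a₂ b : ℕ} (h₁ : b ≤ a₁ + d) (h₁₂ : a₁ ≤ a₂)
    (h₂ : a₂ ≤ b) :
    (1 - q ^ (N + 1)) *
        (admSeries q d k e (L + 1) N a₂ (b - 1) - admSeries q d k e (L + 1) N a₁ (b - 1)) =
      ((q ^ (N + 1)) ^ a₁ - (q ^ (N + 1)) ^ a₂) * ∑ v ∈ Finset.range (e + 1), (q ^ (N + 1)) ^ v *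
        admSeries q d k e L (N + 1) (k + 1 - b - v) (((k + 1 - b - v : ℕ) : ℤ) - 1) := by
  set y := q ^ (N + 1)
  set W := ∑ v ∈ Finset.range (e + 1), y ^ v *
        admSeries q d k e L (N + 1) (k + 1 - b - v) (((k + 1 - b - v : ℕ) : ℤ) - 1) with hW
  have h : admSeries q d k e (L + 1) N a₂ (b - 1) - admSeries q d k e (L + 1) N a₁ (b - 1) =
      (∑ j ∈ Finset.Ico a₁ a₂, y ^ j) * W := by
    rw [admSeries, admSeries, ← Finset.sum_Ico_eq_sub _ h₁₂, Finset.sum_mul]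
    refine Finset.sum_congr rfl fun j hj => ?_
    rw [Finset.mem_Ico] at hj
    rw [hW, Finset.mul_sum]
    refine Finset.sum_congr rfl fun v _ => ?_
    have hr : (((b : ℤ) - 1 - j) % d).toNat = b - 1 - j := by
      rw [Int.emod_eq_of_lt (by omega) (by omega)]
      omega
    rw [hr, pow_add, mul_assoc]
    congr 2
    have hk : k - j - v - (b - 1 - j) = k + 1 - b - v := by omega
    rw [hk]
    by_cases hv : k + 1 - b - v = 0
    · rw [hv, admSeries_zero, admSeries_zero]
    · congr 1
      omega
  rw [h, ← geom_sum_Ico_mul_neg y h₁₂]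
  ring

/-! ### Overpartitions as multiplicity sequences -/

theorem Overpartition.sum_seq {n K : ℕ} (p : Overpartition n) (hK : n < K) :
    ∑ i ∈ Finset.range K, (i + 1) * ((p.seq i).1 + (p.seq i).2) = n := by
  have h1 : p.plain.sum = ∑ i ∈ Finset.range K, (i + 1) * (p.seq i).1 := by
    rw [Finset.sum_multiset_count_of_subset p.plain ((Finset.range K).map (addRightEmbedding 1)),
      Finset.sum_map]
    · exact Finset.sum_congr rfl fun i _ => by
        rw [smul_eq_mul, mul_comm]; rfl
    · intro i hi
      rw [Multiset.mem_toFinset] at hi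
      have h2 := p.plain_pos i hi
      have h3 := Multiset.le_sum_of_mem hi
      have h4 := p.sum_eq
      rw [Finset.mem_map]
      exact ⟨i - 1, Finset.mem_range.2 (by omega), by simp; omega⟩
  have h2 : ∑ i ∈ p.overlined, i = ∑ i ∈ Finset.range K, (i + 1) * (p.seq i).2 := by
    have h3 : ∀ i ∈ Finset.range K, (i + 1) * (p.seq i).2 =
        (fun j => if j ∈ p.overlined then j else 0) (i + 1) := by
      intro i _
      simp [Overpartition.seq, Overpartition.freqOver]
    rw [Finset.sum_congr rfl h3]
    refine Eq.trans ?_ (Finset.sum_map (Finset.range K) (addRightEmbedding 1)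
      (fun j => if j ∈ p.overlined then j else 0))
    rw [← Finset.sum_filter]
    congr 1
    ext i
    simp only [Finset.mem_filter, Finset.mem_map, Finset.mem_range, addRightEmbedding_apply]
    constructor
    · intro hi
      have h4 := p.overlined_pos i hi
      have h5 : i ≤ ∑ j ∈ p.overlined, j :=
        Finset.single_le_sum (f := fun j : ℕ => j) (fun _ _ => Nat.zero_le _) hi
      have h6 := p.sum_eq
      exact ⟨⟨i - 1, by omega, by omega⟩, hi⟩
    · exact fun h => h.2
  refine Eq.trans ?_ p.sum_eq
  rw [h1, h2, ← Finset.sum_add_distrib]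
  exact Finset.sum_congr rfl fun i _ => by rw [mul_add]

theorem Overpartition.seq_injective {n : ℕ} :
    Function.Injective (Overpartition.seq : Overpartition n → ℕ → ℕ × ℕ) := by
  intro p p' h
  have h1 : ∀ i, p.freq (i + 1) = p'.freq (i + 1) := fun i => congrArg Prod.fst (congrFun h i)
  have h2 : ∀ i, p.freqOver (i + 1) = p'.freqOver (i + 1) :=
    fun i => congrArg Prod.snd (congrFun h i)
  ext i
  · rcases i with _ | i
    · rw [Multiset.count_eq_zero_of_notMem fun h => lt_irrefl 0 (p.plain_pos 0 h),
        Multiset.count_eq_zero_of_notMem fun h => lt_irrefl 0 (p'.plain_pos 0 h)]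
    · exact h1 i
  · rcases i with _ | i
    · exact ⟨fun h => absurd (p.overlined_pos 0 h) (lt_irrefl 0),
        fun h => absurd (p'.overlined_pos 0 h) (lt_irrefl 0)⟩
    · have := h2 i
      unfold Overpartition.freqOver at this
      by_cases hp : i + 1 ∈ p.overlined <;> by_cases hp' : i + 1 ∈ p'.overlined <;>
        simp_all

/-- Every finite sequence of the right weight, with overlined multiplicities at most `1`, is the
multiplicity sequence of an overpartition. -/
theorem Overpartition.exists_seq_eq {n K : ℕ} (u : ℕ → ℕ × ℕ) (hu : ∀ i, K ≤ i → u i = (0, 0))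
    (hu1 : ∀ i, (u i).2 ≤ 1) (hn : ∑ i ∈ Finset.range K, (i + 1) * ((u i).1 + (u i).2) = n) :
    ∃ p : Overpartition n, p.seq = u := by
  let P : Multiset ℕ := ∑ i ∈ Finset.range K, Multiset.replicate (u i).1 (i + 1)
  let O : Finset ℕ := {i ∈ Finset.range K | (u i).2 = 1}.map (addRightEmbedding 1)
  have hO : ∑ i ∈ O, i = ∑ i ∈ Finset.range K, (i + 1) * (u i).2 := by
    rw [Finset.sum_map, Finset.sum_filter]
    refine Finset.sum_congr rfl fun i _ => ?_
    have := hu1 i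
    split_ifs with h
    · simp [h]
    · have : (u i).2 = 0 := by omega
      simp [this]
  have hP : P.sum = ∑ i ∈ Finset.range K, (i + 1) * (u i).1 := by
    change Multiset.sumAddMonoidHom P = _
    rw [map_sum]
    refine Finset.sum_congr rfl fun i _ => ?_
    simp [mul_comm]
  refine ⟨⟨P, O, ?_, ?_, ?_⟩, ?_⟩
  · intro i hi
    obtain ⟨j, -, hj⟩ := Multiset.mem_sum.1 hi
    rw [Multiset.eq_of_mem_replicate hj]
    omega
  · intro i hi
    obtain ⟨j, -, rfl⟩ := Finset.mem_map.1 hi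
    simp
  · rw [hO, hP, ← hn, ← Finset.sum_add_distrib]
    exact Finset.sum_congr rfl fun i _ => by rw [mul_add]
  · funext i
    refine Prod.ext ?_ ?_
    · change Multiset.count (i + 1) P = _
      rw [Multiset.count_sum']
      simp only [Multiset.count_replicate, Nat.add_right_cancel_iff, Finset.sum_ite_eq',
        Finset.mem_range]
      split_ifs with h
      · rfl
      · rw [hu i (by omega)]
    · change (if i + 1 ∈ O then 1 else 0) = _
      have hi : i + 1 ∈ O ↔ i < K ∧ (u i).2 = 1 := by
        simp [O]
      rw [if_congr hi rfl rfl]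
      have := hu1 i
      split_ifs with h
      · exact h.2.symm
      · by_cases hK : K ≤ i
        · rw [hu i hK]
        · omega

theorem sum_extend {L B e : ℕ} (g : Fin L → Fin B × Fin (e + 1)) :
    ∑ i ∈ Finset.range L, (i + 1) * ((extend g i).1 + (extend g i).2) = weight 0 g := by
  rw [Finset.sum_range]
  unfold weight
  refine Finset.sum_congr rfl fun i _ => ?_
  simp [extend]
  ring_nf
  simp

/-- Overpartitions of `n` correspond to finite multiplicity sequences of weight `n`. -/
theorem card_overpartition {n K B e : ℕ} (he : e ≤ 1) (hn : n < K) (hB : K ≤ B)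
    (Φ : (ℕ → ℕ × ℕ) → Prop) :
    Nat.card {p : Overpartition n // (∀ i, p.freqOver (i + 1) ≤ e) ∧ Φ p.seq} =
      Nat.card {g : Fin K → Fin B × Fin (e + 1) // Φ (extend g) ∧ weight 0 g = n} := by
  have hle : ∀ (p : Overpartition n) (i : ℕ), p.freq (i + 1) ≤ n ∧ (K ≤ i → p.seq i = (0, 0)) := by
    intro p i
    have h1 := p.sum_seq (K := K + i + 1) (by omega)
    have h2 := Finset.single_le_sum (f := fun i => (i + 1) * ((p.seq i).1 + (p.seq i).2))
      (fun _ _ => Nat.zero_le _) (Finset.mem_range.2 (by omega : i < K + i + 1))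
    simp only [h1] at h2
    constructor
    · change (p.seq i).1 ≤ n
      nlinarith [Nat.zero_le (p.seq i).2, Nat.zero_le (p.seq i).1, Nat.zero_le i]
    · intro hK
      have h3 : (p.seq i).1 + (p.seq i).2 = 0 := by
        by_contra h
        have : 1 ≤ (p.seq i).1 + (p.seq i).2 := by omega
        nlinarith
      exact Prod.ext (by omega) (by omega)
  let F : {p : Overpartition n // (∀ i, p.freqOver (i + 1) ≤ e) ∧ Φ p.seq} →
      Fin K → Fin B × Fin (e + 1) := fun p i =>
    (⟨p.1.freq (i + 1), by have := (hle p.1 i).1; omega⟩,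
      ⟨p.1.freqOver (i + 1), by have := p.2.1 i; omega⟩)
  have hF : ∀ p, extend (F p) = p.1.seq := by
    intro p
    funext i
    unfold extend
    split_ifs with h
    · rfl
    · exact ((hle p.1 i).2 (by omega)).symm
  refine Nat.card_eq_of_bijective (fun p => ⟨F p, ?_, ?_⟩) ⟨?_, ?_⟩
  · rw [hF]
    exact p.2.2
  · rw [← sum_extend, hF]
    exact p.1.sum_seq hn
  · intro p p' h
    have h1 : F p = F p' := congrArg Subtype.val h
    exact Subtype.ext (Overpartition.seq_injective (by rw [← hF, ← hF, h1]))
  · rintro ⟨g, hg, hw⟩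
    have he' : ∀ i, (extend g i).2 ≤ e := by
      intro i
      unfold extend
      split_ifs with h
      · exact Nat.lt_succ_iff.1 (g ⟨i, h⟩).2.2
      · exact Nat.zero_le _
    obtain ⟨p, hp⟩ := Overpartition.exists_seq_eq (K := K) (n := n) (extend g)
      (fun i hi => by simp [extend, Nat.not_lt.2 hi]) (fun i => (he' i).trans he)
      (by rw [sum_extend, hw])
    refine ⟨⟨p, fun i => ?_, by rwa [hp]⟩, ?_⟩
    · change (p.seq i).2 ≤ e
      rw [hp]
      exact he' i
    · refine Subtype.ext ?_
      funext i
      have h1 := (congrFun (hF ⟨p, fun i => by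
        change (p.seq i).2 ≤ e
        rw [hp]
        exact he' i, by rwa [hp]⟩) i).trans (congrFun hp i)
      simp only [extend, i.2, dif_pos, Fin.eta, Prod.mk.injEq] at h1
      exact Prod.ext (Fin.ext h1.1) (Fin.ext h1.2)

open Classical in
/-- The generating function of the overpartitions with a given property of the multiplicity
sequence; weights of at least `K` do not contribute, since `q ^ K = 0`. -/
theorem sum_card_overpartition {K B e : ℕ} (he : e ≤ 1) (hq : q ^ K = 0) (hB : K ≤ B)
    (Φ : (ℕ → ℕ × ℕ) → Prop) :
    ∑ n ∈ Finset.range K, (Nat.card {p : Overpartition n //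
        (∀ i, p.freqOver (i + 1) ≤ e) ∧ Φ p.seq} : R) * q ^ n =
      ∑ g : Fin K → Fin B × Fin (e + 1), if Φ (extend g) then q ^ weight 0 g else 0 := by
  have h1 : ∀ g : Fin K → Fin B × Fin (e + 1), (if Φ (extend g) then q ^ weight 0 g else 0) =
      ∑ n ∈ Finset.range K, if Φ (extend g) ∧ weight 0 g = n then q ^ n else 0 := by
    intro g
    by_cases h : Φ (extend g)
    · simp only [h, if_true, true_and, Finset.sum_ite_eq, Finset.mem_range]
      split_ifs with h2
      · rfl
      · exact pow_eq_zero_of_le (by omega) hq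
    · simp [h]
  rw [Finset.sum_congr rfl fun g _ => h1 g, Finset.sum_comm]
  refine Finset.sum_congr rfl fun n hn => ?_
  rw [card_overpartition he (Finset.mem_range.1 hn) hB, Nat.card_eq_fintype_card,
    Fintype.card_subtype, ← Finset.sum_filter, Finset.sum_const, nsmul_eq_mul]

/-- Partitions are the overpartitions without overlined parts. -/
theorem card_partition {n : ℕ} (Φ : (ℕ → ℕ) → Prop) :
    Nat.card {p : n.Partition // Φ fun i => freq p (i + 1)} =
      Nat.card {p : Overpartition n // (∀ i, p.freqOver (i + 1) ≤ 0) ∧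
        Φ fun i => (p.seq i).1} := by
  have h0 : ∀ p : Overpartition n, (∀ i, p.freqOver (i + 1) ≤ 0) → p.overlined = ∅ := by
    intro p hp
    refine Finset.eq_empty_of_forall_notMem fun i hi => ?_
    have h1 := p.overlined_pos i hi
    have h2 := hp (i - 1)
    rw [Nat.sub_add_cancel h1] at h2
    simp [Overpartition.freqOver, hi] at h2
  refine Nat.card_congr
    { toFun := fun p => ⟨⟨p.1.parts, ∅, fun i hi => p.1.parts_pos hi, by simp,
        by simpa using p.1.parts_sum⟩, fun i => by simp [Overpartition.freqOver], p.2⟩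
      invFun := fun p => ⟨⟨p.1.plain, fun hi => p.1.plain_pos _ hi, by
        have := p.1.sum_eq
        rwa [h0 p.1 p.2.1, Finset.sum_empty, add_zero] at this⟩, p.2.2⟩
      left_inv := fun p => rfl
      right_inv := fun p => by
        refine Subtype.ext (Overpartition.ext rfl ?_)
        exact (h0 p.1 p.2.1).symm }

variable {q}

/-! ### A series solution of the recursion -/

theorem isNilpotent_mul_pow {K i : ℕ} (hq : q ^ K = 0) (hi : 0 < i) (x : R) :
    IsNilpotent (x * q ^ i) :=
  (Commute.all _ _).isNilpotent_mul_left (IsNilpotent.pow_of_pos ⟨K, hq⟩ (by omega))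

theorem isUnit_one_sub_pow {K i : ℕ} (hq : q ^ K = 0) (hi : 0 < i) : IsUnit (1 - q ^ i) := by
  simpa using (isNilpotent_mul_pow hq hi 1).isUnit_one_sub

theorem isUnit_one_add_mul_pow {K i : ℕ} (hq : q ^ K = 0) (hi : 0 < i) (x : R) :
    IsUnit (1 + x * q ^ i) :=
  (isNilpotent_mul_pow hq hi x).isUnit_one_add

/-- The ratio of `q`-shifted factorials
`(q^{d(N+1)}; q^d)_n (-eq; q)_n / ((q^d; q^d)_n (-eq^{N+1}; q)_n)`. -/
noncomputable def qRatio (q : R) (d e N n : ℕ) : R :=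
  ∏ i ∈ Finset.range n, (1 - q ^ (d * (N + i + 1))) * (1 + e * q ^ (i + 1)) *
    Ring.inverse ((1 - q ^ (d * (i + 1))) * (1 + e * q ^ (N + i + 1)))

theorem qRatio_succ {K d : ℕ} (hq : q ^ K = 0) (hd : 0 < d) (e N n : ℕ) :
    qRatio q d e N (n + 1) * ((1 - q ^ (d * (n + 1))) * (1 + e * q ^ (N + n + 1))) =
      qRatio q d e N n * ((1 - q ^ (d * (N + n + 1))) * (1 + e * q ^ (n + 1))) := by
  have hu : IsUnit ((1 - q ^ (d * (n + 1))) * (1 + e * q ^ (N + n + 1))) :=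
    (isUnit_one_sub_pow hq (by positivity)).mul (isUnit_one_add_mul_pow hq (by omega) _)
  rw [qRatio, Finset.prod_range_succ, ← qRatio, mul_assoc, mul_assoc,
    Ring.inverse_mul_cancel _ hu, mul_one]

theorem qRatio_shift {K d : ℕ} (hq : q ^ K = 0) (hd : 0 < d) (e N n : ℕ) :
    qRatio q d e (N + 1) n * ((1 - q ^ (d * (N + 1))) * (1 + e * q ^ (N + n + 1))) =
      qRatio q d e N n * ((1 - q ^ (d * (N + n + 1))) * (1 + e * q ^ (N + 1))) := by
  induction n with
  | zero => simp [qRatio]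
  | succ n ih =>
    have h1 := qRatio_succ hq hd e N n
    have h2 := qRatio_succ hq hd e (N + 1) n
    have hu : IsUnit ((1 - q ^ (d * (n + 1))) * (1 + e * q ^ (N + n + 1))) :=
      (isUnit_one_sub_pow hq (by positivity)).mul (isUnit_one_add_mul_pow hq (by omega) _)
    refine hu.mul_left_cancel ?_
    have e1 : N + 1 + n + 1 = N + (n + 1) + 1 := by ring
    rw [e1] at h2
    linear_combination (1 - q ^ (d * (N + 1))) * (1 + e * q ^ (N + n + 1)) * h2 +
      (1 - q ^ (d * (N + (n + 1) + 1))) * (1 + e * q ^ (n + 1)) * ih -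
      (1 - q ^ (d * (N + (n + 1) + 1))) * (1 + e * q ^ (N + 1)) * h1

theorem qRatio_zero_left {K d : ℕ} (hq : q ^ K = 0) (hd : 0 < d) (e n : ℕ) :
    qRatio q d e 0 n = 1 := by
  refine Finset.prod_eq_one fun i _ => ?_
  rw [zero_add]
  exact Ring.mul_inverse_cancel _
    ((isUnit_one_sub_pow hq (by positivity)).mul (isUnit_one_add_mul_pow hq (by omega) _))

/-- The coefficient of the `n`-th summand of `thetaSeries`. -/
noncomputable def thetaCoeff (q : R) (d h e N n : ℕ) : R :=
  (-1) ^ n * q ^ (h * n * N) * qRatio q d e N n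

/-- A truncation of the Andrews-type series
`∑ₙ (-1)ⁿ x^{hn} q^{M n(n+1)/2} (qRatio) (q^{-an} - x^a q^{(n+1)a})` at `x = q^N`, where
`h = k + 1 - d` and `M = 2h + d - e`. Negative exponents are avoided by writing
`M n(n+1)/2 - an = M n(n-1)/2 + (M-a)n`. -/
noncomputable def thetaSeries (q : R) (d h e L N a : ℕ) : R :=
  ∑ n ∈ Finset.range L, thetaCoeff q d h e N n *
    (q ^ ((2 * h + d - e) * n.choose 2 + (2 * h + d - e - a) * n) -
      q ^ ((2 * h + d - e) * (n.choose 2 + n) + (n + 1 + N) * a))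

theorem thetaCoeff_succ {K d : ℕ} (hq : q ^ K = 0) (hd : 0 < d) (h e N n : ℕ) :
    thetaCoeff q d h e N (n + 1) * ((1 - q ^ (d * (n + 1))) * (1 + e * q ^ (N + n + 1))) =
      -q ^ (h * N) * thetaCoeff q d h e N n *
        ((1 - q ^ (d * (N + n + 1))) * (1 + e * q ^ (n + 1))) := by
  unfold thetaCoeff
  linear_combination (-1) ^ (n + 1) * q ^ (h * (n + 1) * N) * qRatio_succ hq hd e N n

theorem thetaCoeff_shift {K d : ℕ} (hq : q ^ K = 0) (hd : 0 < d) (h e N n : ℕ) :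
    thetaCoeff q d h e (N + 1) n * ((1 - q ^ (d * (N + 1))) * (1 + e * q ^ (N + n + 1))) =
      q ^ (h * n) * thetaCoeff q d h e N n *
        ((1 - q ^ (d * (N + n + 1))) * (1 + e * q ^ (N + 1))) := by
  unfold thetaCoeff
  linear_combination (-1) ^ n * q ^ (h * n * (N + 1)) * qRatio_shift hq hd e N n

/-- The recursion for the summands: those of the shifted series combine one half of the `n`-th
and one half of the `(n + 1)`-st summand of the original series. -/
theorem thetaSeries_summand {K d : ℕ} (hq : q ^ K = 0) (hd : 0 < d) {h e a b s₁ s₂ : ℕ}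
    (he : e ≤ 1) (hh : 1 ≤ h) (h₁ : h + d = a + b + e) (h₂ : s₂ + d = s₁ + a) (N n : ℕ) :
    (1 + e * q ^ (N + 1)) *
      (thetaCoeff q d h e N (n + 1) * (1 - q ^ (d * (n + 1))) *
        q ^ ((N + 1) * s₁ + (2 * h + d - e) * (n.choose 2 + n) + (h + b) * (n + 1)) +
      thetaCoeff q d h e N n * (1 - q ^ (d * (N + n + 1))) *
        q ^ ((N + 1) * s₂ + (2 * h + d - e) * n.choose 2 + (2 * h - e + a) * n)) =
    (q ^ (N + 1)) ^ s₂ * (1 - q ^ (d * (N + 1))) * (thetaCoeff q d h e (N + 1) n *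
      ((q ^ ((2 * h + d - e) * n.choose 2 + (2 * h + d - e - (b + e)) * n) -
        q ^ ((2 * h + d - e) * (n.choose 2 + n) + (n + 1 + (N + 1)) * (b + e))) +
      e * q ^ (N + 1) * (q ^ ((2 * h + d - e) * n.choose 2 + (2 * h + d - e - b) * n) -
        q ^ ((2 * h + d - e) * (n.choose 2 + n) + (n + 1 + (N + 1)) * b)))) := by
  have hu : IsUnit (1 + (e : R) * q ^ (N + n + 1)) := isUnit_one_add_mul_pow hq (by omega) _
  refine hu.mul_left_cancel ?_
  have r1 := thetaCoeff_succ hq hd h e N n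
  have r2 := thetaCoeff_shift hq hd h e N n
  generalize thetaCoeff q d h e N n = C at *
  generalize thetaCoeff q d h e N (n + 1) = C1 at *
  generalize thetaCoeff q d h e (N + 1) n = C' at *
  generalize n.choose 2 = T
  obtain ⟨M, hM⟩ : ∃ M, M = 2 * h + d - e := ⟨_, rfl⟩
  have hb : M - (b + e) = h + a - e := by omega
  have hb' : M - b = h + a := by omega
  rw [← hM, hb, hb', ← pow_mul]
  have hp : q ^ (M * T + (h + a - e) * n) + e * q ^ (N + 1) * q ^ (M * T + (h + a) * n) =
      q ^ (M * T + (h + a - e) * n) * (1 + e * q ^ (N + n + 1)) := by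
    rcases Nat.le_one_iff_eq_zero_or_eq_one.1 he with rfl | rfl
    · simp
    · obtain ⟨j, hj⟩ : ∃ j, h + a = j + 1 := ⟨h + a - 1, by omega⟩
      rw [hj, Nat.add_sub_cancel]
      push_cast
      ring
  have hm : q ^ (M * (T + n) + (n + 1 + (N + 1)) * (b + e)) +
      e * q ^ (N + 1) * q ^ (M * (T + n) + (n + 1 + (N + 1)) * b) =
      q ^ (M * (T + n) + (n + 1 + (N + 1)) * b + e * (N + 1)) * (1 + e * q ^ (n + 1)) := by
    rcases Nat.le_one_iff_eq_zero_or_eq_one.1 he with rfl | rfl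
    · simp
    · push_cast
      ring
  have hE1 : q ^ (h * n) * q ^ ((N + 1) * s₂) * q ^ (M * T + (h + a - e) * n) =
      q ^ ((N + 1) * s₂ + M * T + (2 * h - e + a) * n) := by
    rw [← pow_add, ← pow_add, show 2 * h - e + a = h + (h + a - e) by omega]
    ring_nf
  have hE2 : q ^ (h * N) * q ^ ((N + 1) * s₁ + M * (T + n) + (h + b) * (n + 1)) =
      q ^ (h * n) * q ^ ((N + 1) * s₂) *
        q ^ (M * (T + n) + (n + 1 + (N + 1)) * b + e * (N + 1)) := by
    rw [← pow_add, ← pow_add, ← pow_add]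
    congr 1
    have h3 : h + s₁ = s₂ + b + e := by omega
    linear_combination (N + 1) * h3
  generalize q ^ (M * T + (h + a - e) * n) = B1 at *
  generalize q ^ (M * T + (h + a) * n) = B3 at *
  generalize q ^ (M * (T + n) + (n + 1 + (N + 1)) * (b + e)) = B2 at *
  generalize q ^ (M * (T + n) + (n + 1 + (N + 1)) * b) = B4 at *
  generalize q ^ (M * (T + n) + (n + 1 + (N + 1)) * b + e * (N + 1)) = B5 at *
  generalize q ^ ((N + 1) * s₂ + M * T + (2 * h - e + a) * n) = A2 at *
  generalize q ^ ((N + 1) * s₁ + M * (T + n) + (h + b) * (n + 1)) = A1 at *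
  generalize q ^ ((N + 1) * s₂) = Y at *
  generalize q ^ (N + 1) = y at *
  generalize q ^ (h * n) = X1 at *
  generalize q ^ (h * N) = X2 at *
  generalize q ^ (N + n + 1) = v at *
  generalize q ^ (n + 1) = w at *
  generalize q ^ (d * (n + 1)) = x1 at *
  generalize q ^ (d * (N + n + 1)) = x2 at *
  generalize q ^ (d * (N + 1)) = x3 at *
  linear_combination (1 + e * y) * A1 * r1 - Y * ((B1 + e * y * B3) - (B2 + e * y * B4)) * r2 +
    C * (1 - x2) * (1 + e * y) * (-(1 + e * v) * hE1 - (1 + e * w) * hE2 - X1 * Y * (hp - hm))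

/-- The recursion for `thetaSeries`, in a form that covers both signs of `a - d = s₂ - s₁`. -/
theorem thetaSeries_sum {K d : ℕ} (hq : q ^ K = 0) (hd : 0 < d) {h e a b s₁ s₂ : ℕ}
    (he : e ≤ 1) (hh : 1 ≤ h) (h₁ : h + d = a + b + e) (h₂ : s₂ + d = s₁ + a) (N : ℕ) {L : ℕ}
    (hL : K ≤ L) :
    (1 + e * q ^ (N + 1)) * ∑ n ∈ Finset.range L,
      (thetaCoeff q d h e N n * (1 - q ^ (d * n)) *
        q ^ ((N + 1) * s₁ + (2 * h + d - e) * n.choose 2 + (h + b) * n) +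
      thetaCoeff q d h e N n * (1 - q ^ (d * (N + n + 1))) *
        q ^ ((N + 1) * s₂ + (2 * h + d - e) * n.choose 2 + (2 * h - e + a) * n)) =
    (q ^ (N + 1)) ^ s₂ * (1 - q ^ (d * (N + 1))) * (thetaSeries q d h e L (N + 1) (b + e) +
      e * q ^ (N + 1) * thetaSeries q d h e L (N + 1) b) := by
  have hch : ∀ n : ℕ, (n + 1).choose 2 = n.choose 2 + n := fun n => by
    rw [Nat.choose_succ_succ' n 1, Nat.choose_one_right, add_comm]
  set α : ℕ → R := fun n => thetaCoeff q d h e N n * (1 - q ^ (d * n)) *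
        q ^ ((N + 1) * s₁ + (2 * h + d - e) * n.choose 2 + (h + b) * n) with hα
  have h0 : α 0 = 0 := by simp [hα]
  have hα1 : ∀ n, α (n + 1) = thetaCoeff q d h e N (n + 1) * (1 - q ^ (d * (n + 1))) *
        q ^ ((N + 1) * s₁ + (2 * h + d - e) * (n.choose 2 + n) + (h + b) * (n + 1)) := by
    intro n
    simp only [hα, hch]
  -- The sum telescopes: its boundary terms are `α 0 = 0` and `α L`, of order at least `L ≥ K`.
  have hαL : α L = 0 := by
    have : q ^ ((N + 1) * s₁ + (2 * h + d - e) * L.choose 2 + (h + b) * L) = 0 := by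
      refine pow_eq_zero_of_le ?_ hq
      nlinarith [Nat.zero_le ((N + 1) * s₁), Nat.zero_le ((2 * h + d - e) * L.choose 2),
        Nat.zero_le (b * L)]
    simp only [hα, this, mul_zero]
  have hs : ∑ n ∈ Finset.range L, α n = ∑ n ∈ Finset.range L, α (n + 1) := by
    have h1 := Finset.sum_range_succ α L
    rw [Finset.sum_range_succ', h0, hαL, add_zero, add_zero] at h1
    exact h1.symm
  rw [Finset.sum_add_distrib, hs, ← Finset.sum_add_distrib, Finset.mul_sum, thetaSeries,
    thetaSeries, Finset.mul_sum, ← Finset.sum_add_distrib, Finset.mul_sum]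
  refine Finset.sum_congr rfl fun n _ => ?_
  rw [hα1, thetaSeries_summand hq hd he hh h₁ h₂]
  ring

/-- The recursion for `a = t + d`. -/
theorem thetaSeries_sub {K d : ℕ} (hq : q ^ K = 0) (hd : 0 < d) {h e t b : ℕ}
    (he : e ≤ 1) (hh : 1 ≤ h) (h₁ : h = t + b + e) (N : ℕ) {L : ℕ} (hL : K ≤ L) :
    (1 + e * q ^ (N + 1)) * (thetaSeries q d h e L N (t + d) - thetaSeries q d h e L N t) =
    (q ^ (N + 1)) ^ t * (1 - (q ^ (N + 1)) ^ d) * (thetaSeries q d h e L (N + 1) (b + e) +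
      e * q ^ (N + 1) * thetaSeries q d h e L (N + 1) b) := by
  have key := thetaSeries_sum hq hd (a := t + d) (b := b) (s₁ := 0) (s₂ := t) he hh (by omega)
    (by omega) N hL
  rw [← pow_mul q (N + 1) d, mul_comm (N + 1) d, ← key, thetaSeries, thetaSeries,
    ← Finset.sum_sub_distrib]
  congr 1
  refine Finset.sum_congr rfl fun n _ => ?_
  obtain ⟨M, hM⟩ : ∃ M, M = 2 * h + d - e := ⟨_, rfl⟩
  have e1 : M - (t + d) = h + b := by omega
  have e2 : M - t = h + b + d := by omega
  have e3 : 2 * h - e + (t + d) = M + t := by omega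
  rw [← hM, e1, e2, e3]
  ring

/-- The recursion for `d = 2 a`, where the summand for `a - d = -a` is `-y^{-a}` times the one
for `a`. -/
theorem thetaSeries_half {K d : ℕ} (hq : q ^ K = 0) {h e a b : ℕ} (hd : d = 2 * a)
    (ha : 0 < a) (he : e ≤ 1) (hh : 1 ≤ h) (h₁ : h + a = b + e) (N : ℕ) {L : ℕ} (hL : K ≤ L) :
    (1 + e * q ^ (N + 1)) * ((1 + (q ^ (N + 1)) ^ a) * thetaSeries q d h e L N a) =
    (1 - (q ^ (N + 1)) ^ d) * (thetaSeries q d h e L (N + 1) (b + e) +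
      e * q ^ (N + 1) * thetaSeries q d h e L (N + 1) b) := by
  have key := thetaSeries_sum hq (d := d) (by omega) (a := a) (b := b) (s₁ := a) (s₂ := 0) he hh
    (by omega) (by omega) N hL
  rw [pow_zero, one_mul] at key
  rw [← pow_mul q (N + 1) d, mul_comm (N + 1) d, ← key, thetaSeries, Finset.mul_sum]
  congr 1
  refine Finset.sum_congr rfl fun n _ => ?_
  obtain ⟨M, hM⟩ : ∃ M, M = 2 * h + d - e := ⟨_, rfl⟩
  have e1 : M - a = h + b := by omega
  have e2 : 2 * h - e + a = h + b := by omega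
  have e3 : M = h + b + a := by omega
  rw [← hM, e1, e2, e3, hd]
  ring

/-- At `x = q ^ K = 0` only the first term of the summand `n = 0` remains. -/
theorem thetaSeries_top {K d h e a L : ℕ} (hq : q ^ K = 0) (hh : 1 ≤ h) (ha : 0 < a)
    (hL : 0 < L) : thetaSeries q d h e L K a = 1 := by
  obtain ⟨L, rfl⟩ : ∃ j, L = j + 1 := ⟨L - 1, by omega⟩
  rw [thetaSeries, Finset.sum_range_succ', Finset.sum_eq_zero, zero_add]
  · have : q ^ ((2 * h + d - e) * (Nat.choose 0 2 + 0) + (0 + 1 + K) * a) = 0 := by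
      refine pow_eq_zero_of_le ?_ hq
      simp
      nlinarith
    rw [this]
    simp [thetaCoeff, qRatio]
  · intro n _
    have : q ^ (h * (n + 1) * K) = 0 := by
      refine pow_eq_zero_of_le ?_ hq
      exact Nat.le_mul_of_pos_left _ (by positivity)
    simp [thetaCoeff, this]

theorem thetaSeries_zero (d h e L N : ℕ) : thetaSeries q d h e L N 0 = 0 := by
  refine Finset.sum_eq_zero fun n _ => ?_
  have : (2 * h + d - e) * n.choose 2 + (2 * h + d - e - 0) * n =
      (2 * h + d - e) * (n.choose 2 + n) + (n + 1 + N) * 0 := by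
    rw [Nat.sub_zero]
    ring
  rw [this, sub_self, mul_zero]

/-! ### The series solution counts admissible sequences -/

/-- Both sides obey the same recursion, which expresses the values at `N` by those at `N + 1`, and
both are `1` at `N = K`, as `q ^ K = 0`. -/
theorem admSeries_mul_prod {K d h e k : ℕ} (hq : q ^ K = 0) (hK : 0 < K) (hd : 0 < d)
    (he : e ≤ 1) (hh : 1 ≤ h) (hk : h + d = k + 1) (hdk : d ∣ 2 * (k + 1)) (hde : d ∣ 2 * e)
    (L : ℕ) : ∀ N, N + L = K → ∀ a, a + e ≤ k + 1 → d ∣ 2 * a →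
    admSeries q d k e L N a (a - 1) * ∏ i ∈ Finset.range L, (1 - q ^ (N + i + 1)) =
      (∏ i ∈ Finset.range L, (1 + e * q ^ (N + i + 1))) * thetaSeries q d h e K N a := by
  induction L with
  | zero =>
    intro N hN a _ _
    obtain rfl : N = K := by omega
    rcases Nat.eq_zero_or_pos a with rfl | ha
    · simp [admSeries, thetaSeries_zero]
    · simp [admSeries, ha, thetaSeries_top hq hh ha hK]
  | succ L ih =>
    intro N hN a
    have hp : ∀ F : ℕ → R, ∏ i ∈ Finset.range (L + 1), F (N + i + 1) =
        (∏ i ∈ Finset.range L, F (N + 1 + i + 1)) * F (N + 1) := by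
      intro F
      rw [Finset.prod_range_succ']
      congr 1
      refine Finset.prod_congr rfl fun i _ => ?_
      congr 1
      omega
    rw [hp fun i => 1 - q ^ i, hp fun i => 1 + e * q ^ i]
    set A := ∏ i ∈ Finset.range L, (1 - q ^ (N + 1 + i + 1))
    set B := ∏ i ∈ Finset.range L, (1 + e * q ^ (N + 1 + i + 1))
    have hW : ∀ b a, 0 < a → a + b + e = k + 1 → d ∣ 2 * a →
        (∑ v ∈ Finset.range (e + 1), (q ^ (N + 1)) ^ v *
          admSeries q d k e L (N + 1) (k + 1 - a - v) (((k + 1 - a - v : ℕ) : ℤ) - 1)) * A =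
        B * (thetaSeries q d h e K (N + 1) (b + e) +
          e * q ^ (N + 1) * thetaSeries q d h e K (N + 1) b) := by
      intro b a ha0 hab ha
      have h1 := ih (N + 1) (by omega) (b + e) (by omega) (by
        rw [show 2 * (b + e) = 2 * (k + 1) - 2 * a by omega]
        exact Nat.dvd_sub hdk ha)
      have h2 := ih (N + 1) (by omega) b (by omega) (by
        rw [show 2 * b = 2 * (k + 1) - 2 * a - 2 * e by omega]
        exact Nat.dvd_sub (Nat.dvd_sub hdk ha) hde)
      have e1 : k + 1 - a = b + e := by omega
      rw [e1]
      rcases Nat.le_one_iff_eq_zero_or_eq_one.1 he with rfl | rfl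
      · simp only [zero_add, Finset.sum_range_one, pow_zero, one_mul, Nat.sub_zero]
        rw [add_zero b] at h1 ⊢
        rw [Nat.cast_zero, zero_mul, zero_mul, add_zero, h1]
      · simp only [Finset.sum_range_succ, Finset.sum_range_zero, pow_zero, one_mul, Nat.sub_zero,
          zero_add, pow_one, Nat.add_sub_cancel, Nat.cast_one]
        linear_combination h1 + q ^ (N + 1) * h2
    induction a using Nat.strong_induction_on with
    | _ a iha =>
      intro ha hda
      rcases Nat.eq_zero_or_pos a with rfl | ha0
      · simp [admSeries_zero, thetaSeries_zero]
      · by_cases had : d ≤ a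
        · obtain ⟨t, rfl⟩ : ∃ t, a = t + d := ⟨a - d, by omega⟩
          have hdt : d ∣ 2 * t := by
            rw [show 2 * t = 2 * (t + d) - d * 2 by omega]
            exact Nat.dvd_sub hda (dvd_mul_right _ _)
          obtain ⟨b, hb⟩ : ∃ b, t + d + b + e = k + 1 := ⟨k + 1 - e - (t + d), by omega⟩
          have h1 := iha t (by omega) (by omega) hdt
          have h2 := admSeries_sub q (d := d) (k := k) (e := e) L N (a₁ := t) (a₂ := t + d)
            (b := t + d) le_rfl (by omega) le_rfl
          have h3 : admSeries q d k e (L + 1) N t (((t + d : ℕ) : ℤ) - 1) =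
              admSeries q d k e (L + 1) N t ((t : ℤ) - 1) := by
            refine admSeries_congr q _ _ _ ?_
            refine (Int.ModEq.sub_right 1 ?_)
            push_cast
            exact Int.add_modEq_right
          rw [h3] at h2
          have h4 := thetaSeries_sub hq hd (h := h) (t := t) he hh (by omega : h = t + b + e) N
            (le_refl K)
          have h5 := hW b (t + d) ha0 hb hda
          linear_combination h1 + A * h2 + (q ^ (N + 1)) ^ t * (1 - (q ^ (N + 1)) ^ d) * h5 - B * h4
        · -- As `d ∣ 2 * a` and `0 < a < d`, this is the case `a = d / 2`.
          have hd2 : d = 2 * a := by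
            obtain ⟨c, hc⟩ := hda
            have hc1 : c < 2 := by
              by_contra h
              have : d * 2 ≤ d * c := Nat.mul_le_mul_left d (by omega)
              omega
            interval_cases c <;> omega
          obtain ⟨b, hb⟩ : ∃ b, a + b + e = k + 1 := ⟨k + 1 - e - a, by omega⟩
          have h2 := admSeries_sub q (d := d) (k := k) (e := e) L N (a₁ := 0) (a₂ := a)
            (b := a) (by omega) (by omega) le_rfl
          rw [admSeries_zero, sub_zero, pow_zero] at h2
          have h4 := thetaSeries_half hq (h := h) (a := a) (b := b) hd2 ha0 he hh (by omega) N
            (le_refl K)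
          have h5 := hW b a ha0 hb hda
          have hu : IsUnit (1 + (q ^ (N + 1)) ^ a) := by
            rw [← pow_mul]
            simpa using isUnit_one_add_mul_pow hq (i := (N + 1) * a) (by positivity) 1
          refine hu.mul_left_cancel ?_
          have e2 : (q ^ (N + 1)) ^ d = ((q ^ (N + 1)) ^ a) ^ 2 := by
            rw [hd2, mul_comm 2 a, pow_mul]
          rw [e2] at h4
          linear_combination (1 + (q ^ (N + 1)) ^ a) * A * h2 - B * h4 +
            (1 + (q ^ (N + 1)) ^ a) * (1 - (q ^ (N + 1)) ^ a) * h5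

/-! ### The Jacobi triple product -/

/-- The Gaussian binomial coefficient. -/
def gaussBinom (Q : R) : ℕ → ℕ → R
  | _, 0 => 1
  | 0, _ + 1 => 0
  | n + 1, j + 1 => gaussBinom Q n (j + 1) + Q ^ (n - j) * gaussBinom Q n j

theorem gaussBinom_zero_right (Q : R) (n : ℕ) : gaussBinom Q n 0 = 1 := by
  cases n <;> rfl

theorem gaussBinom_eq_zero (Q : R) {n j : ℕ} (h : n < j) : gaussBinom Q n j = 0 := by
  induction n generalizing j with
  | zero =>
    obtain ⟨j, rfl⟩ : ∃ i, j = i + 1 := ⟨j - 1, by omega⟩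
    rfl
  | succ n ih =>
    obtain ⟨j, rfl⟩ : ∃ i, j = i + 1 := ⟨j - 1, by omega⟩
    rw [gaussBinom, ih (by omega), ih (by omega), mul_zero, add_zero]

/-- The `Q`-factorial `(Q; Q)_n`. -/
def qFact (Q : R) (n : ℕ) : R := ∏ i ∈ Finset.range n, (1 - Q ^ (i + 1))

theorem qFact_succ (Q : R) (n : ℕ) : qFact Q (n + 1) = qFact Q n * (1 - Q ^ (n + 1)) :=
  Finset.prod_range_succ _ _

theorem gaussBinom_mul_qFact (Q : R) (i j : ℕ) :
    gaussBinom Q (i + j) j * (qFact Q j * qFact Q i) = qFact Q (i + j) := by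
  obtain ⟨n, hn⟩ : ∃ n, n = i + j := ⟨_, rfl⟩
  rw [← hn]
  induction n generalizing i j with
  | zero =>
    obtain ⟨rfl, rfl⟩ : i = 0 ∧ j = 0 := by omega
    simp [gaussBinom, qFact]
  | succ n ih =>
    rcases j with _ | j
    · obtain rfl : i = n + 1 := by omega
      rw [gaussBinom_zero_right]
      simp [qFact]
    · rw [gaussBinom, qFact_succ Q n, show n - j = i by omega]
      have h1 := ih i j (by omega)
      rcases i with _ | i
      · obtain rfl : j = n := by omega
        rw [gaussBinom_eq_zero Q (Nat.lt_succ_self _), qFact_succ]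
        linear_combination (1 - Q ^ (j + 1)) * h1
      · have h2 := ih i (j + 1) (by omega)
        obtain rfl : n = i + j + 1 := by omega
        rw [qFact_succ] at h1 h2 ⊢
        rw [qFact_succ Q i]
        linear_combination (1 - Q ^ (i + 1)) * h2 + Q ^ (i + 1) * (1 - Q ^ (j + 1)) * h1

theorem isUnit_qFact {K : ℕ} {Q : R} (hQ : Q ^ K = 0) (n : ℕ) : IsUnit (qFact Q n) := by
  unfold qFact
  induction n with
  | zero => simp
  | succ n ih =>
    rw [Finset.prod_range_succ]
    exact ih.mul (isUnit_one_sub_pow hQ (Nat.succ_pos n))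

/-- Symmetry, deduced from the product formula in the case that the factorials are units. -/
theorem gaussBinom_symm {K : ℕ} {Q : R} (hQ : Q ^ K = 0) (i j : ℕ) :
    gaussBinom Q (i + j) j = gaussBinom Q (i + j) i := by
  refine ((isUnit_qFact hQ j).mul (isUnit_qFact hQ i)).mul_right_cancel ?_
  rw [gaussBinom_mul_qFact, mul_comm (qFact Q j), add_comm i j, gaussBinom_mul_qFact]

/-- The `j`-th term, counted from `-l`, of the bilateral series `∑ₙ zⁿ (zw)^{n(n-1)/2}`. The terms
with `n < 0` are expressed by `w` in place of `z⁻¹`. -/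
def bilateralTerm (z w : R) (l j : ℕ) : R :=
  if l ≤ j then z ^ (j - l) * (z * w) ^ (j - l).choose 2
  else w ^ (l - j) * (z * w) ^ (l - j).choose 2

theorem choose_two_succ (n : ℕ) : (n + 1).choose 2 = n.choose 2 + n := by
  rw [Nat.choose_succ_succ' n 1, Nat.choose_one_right, add_comm]

/-- Multiplication by `z Qᵐ` moves each term of the bilateral series to the next one; for negative
indices this uses `z w = Q`. -/
theorem bilateralTerm_succ (z w : R) {l j m : ℕ} (h : j ≤ l + m) :
    z * (z * w) ^ m * bilateralTerm z w l j =
      (z * w) ^ (l + m - j) * bilateralTerm z w l (j + 1) := by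
  unfold bilateralTerm
  by_cases h1 : l ≤ j
  · obtain ⟨n, rfl⟩ : ∃ n, j = l + n := ⟨j - l, by omega⟩
    obtain ⟨p, rfl⟩ : ∃ p, m = n + p := ⟨m - n, by omega⟩
    rw [if_pos h1, if_pos (by omega), show l + n - l = n by omega,
      show l + n + 1 - l = n + 1 by omega, show l + (n + p) - (l + n) = p by omega,
      choose_two_succ]
    ring
  · obtain ⟨n, rfl⟩ : ∃ n, l = j + n + 1 := ⟨l - j - 1, by omega⟩
    rw [if_neg h1, show j + n + 1 - j = n + 1 by omega, show j + n + 1 + m - j = n + 1 + m by omega,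
      choose_two_succ]
    rcases n with _ | n
    · rw [if_pos (by omega), show j + 1 - (j + 0 + 1) = 0 by omega]
      simp
      ring
    · rw [if_neg (by omega), show j + (n + 1) + 1 - (j + 1) = n + 1 by omega]
      ring

/-- The inductive step for the finite triple product: a further factor `1 - z Qᵐ` amounts to
Pascal's rule. -/
theorem sum_gaussBinom_mul_one_sub (z w : R) (l m : ℕ) :
    (∑ j ∈ Finset.range (l + m + 1),
      (-1) ^ j * gaussBinom (z * w) (l + m) j * bilateralTerm z w l j) * (1 - z * (z * w) ^ m) =
    ∑ j ∈ Finset.range (l + m + 2),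
      (-1) ^ j * gaussBinom (z * w) (l + m + 1) j * bilateralTerm z w l j := by
  rw [Finset.sum_range_succ' _ (l + m + 1)]
  have h1 : ∀ j ∈ Finset.range (l + m + 1), (-1 : R) ^ (j + 1) *
      gaussBinom (z * w) (l + m + 1) (j + 1) * bilateralTerm z w l (j + 1) =
      (-1) ^ (j + 1) * gaussBinom (z * w) (l + m) (j + 1) * bilateralTerm z w l (j + 1) -
      (-1) ^ j * gaussBinom (z * w) (l + m) j * bilateralTerm z w l j * (z * (z * w) ^ m) := by
    intro j hj
    rw [gaussBinom]
    have h2 := bilateralTerm_succ z w (l := l) (j := j) (m := m)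
      (by have := Finset.mem_range.1 hj; omega)
    linear_combination (-1) ^ j * gaussBinom (z * w) (l + m) j * h2
  rw [Finset.sum_congr rfl h1, Finset.sum_sub_distrib, ← Finset.sum_mul]
  have h3 := Finset.sum_range_succ' (fun j => (-1) ^ j * gaussBinom (z * w) (l + m) j *
    bilateralTerm z w l j) (l + m + 1)
  rw [Finset.sum_range_succ, gaussBinom_eq_zero _ (Nat.lt_succ_self _), mul_zero, zero_mul,
    add_zero] at h3
  rw [gaussBinom_zero_right] at h3 ⊢
  linear_combination h3

theorem prod_one_sub_eq_sum (z w : R) (m : ℕ) :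
    ∏ i ∈ Finset.range m, (1 - z * (z * w) ^ i) = ∑ j ∈ Finset.range (m + 1),
      (-1) ^ j * gaussBinom (z * w) m j * bilateralTerm z w 0 j := by
  induction m with
  | zero => simp [gaussBinom, bilateralTerm]
  | succ m ih =>
    have h := sum_gaussBinom_mul_one_sub z w 0 m
    simp only [zero_add] at h
    rw [Finset.prod_range_succ, ih, h]

/-- A finite form of the Jacobi triple product, due to MacMahon. -/
theorem prod_mul_prod_eq_sum {K : ℕ} {z w : R} (hQ : (z * w) ^ K = 0) (l m : ℕ) :
    (∏ i ∈ Finset.range l, (1 - w * (z * w) ^ i)) * ∏ i ∈ Finset.range m, (1 - z * (z * w) ^ i) =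
      (-1) ^ l * ∑ j ∈ Finset.range (l + m + 1),
        (-1) ^ j * gaussBinom (z * w) (l + m) j * bilateralTerm z w l j := by
  induction m with
  | zero =>
    have h := prod_one_sub_eq_sum w z l
    rw [mul_comm w z] at h
    rw [h, Finset.range_zero, Finset.prod_empty, mul_one, add_zero, Finset.mul_sum,
      ← Finset.sum_range_reflect]
    refine Finset.sum_congr rfl fun j hj => ?_
    have hj := Finset.mem_range.1 hj
    obtain ⟨i, rfl⟩ : ∃ i, l = i + j := ⟨l - j, by omega⟩
    rw [show i + j + 1 - 1 - j = i by omega, gaussBinom_symm hQ]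
    have h1 : bilateralTerm w z 0 i = bilateralTerm z w (i + j) j := by
      unfold bilateralTerm
      rw [if_pos (Nat.zero_le _), mul_comm w z]
      rcases i with _ | i
      · simp
      · rw [if_neg (by omega), Nat.add_sub_cancel, Nat.sub_zero]
    rw [h1, pow_add]
    have h2 : (-1 : R) ^ j * (-1) ^ j = 1 := by rw [← mul_pow]; simp
    linear_combination -(-1) ^ i * gaussBinom (z * w) (i + j) i *
      bilateralTerm z w (i + j) j * h2
  | succ m ih =>
    have h := sum_gaussBinom_mul_one_sub z w l m
    rw [Finset.prod_range_succ, ← mul_assoc, ih, mul_assoc, h]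
    rfl

/-- `(Q; Q)_j` may be replaced by `(Q; Q)_i` next to a factor that kills the higher powers
of `Q`. -/
theorem mul_qFact_eq {x Q : R} {i j : ℕ} (hij : i ≤ j) (h : ∀ n, i < n → x * Q ^ n = 0) :
    x * qFact Q j = x * qFact Q i := by
  induction j, hij using Nat.le_induction with
  | base => rfl
  | succ j hj ih =>
    rw [qFact_succ]
    linear_combination ih - qFact Q j * h (j + 1) (by omega)

/-- The Jacobi triple product, for `z` and `w` in place of `z` and `Q / z`; it is exact as all
monomials in `z`, `w` of degree at least `K` vanish. -/
theorem jacobi_triple_product {K : ℕ} {z w : R} (h : ∀ i j, K ≤ i + j → z ^ i * w ^ j = 0) :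
    ∑ n ∈ Finset.range K, (-1) ^ n *
        (w ^ n * (z * w) ^ n.choose 2 - z ^ (n + 1) * (z * w) ^ (n + 1).choose 2) =
      qFact (z * w) K * ((∏ i ∈ Finset.range K, (1 - w * (z * w) ^ i)) *
        ∏ i ∈ Finset.range K, (1 - z * (z * w) ^ i)) := by
  have hQ : (z * w) ^ K = 0 := by rw [mul_pow, h K K (by omega)]
  rw [prod_mul_prod_eq_sum hQ, mul_left_comm, Finset.mul_sum]
  -- The factor `(Q; Q)_K` cancels the Gaussian binomial coefficients, up to terms that vanish.
  have h0 : ∀ j ∈ Finset.range (K + K + 1), qFact (z * w) K *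
      ((-1) ^ j * gaussBinom (z * w) (K + K) j * bilateralTerm z w K j) =
      (-1) ^ j * bilateralTerm z w K j := by
    intro j hj
    have hj := Finset.mem_range.1 hj
    obtain ⟨i, hi⟩ : ∃ i, K + K = i + j := ⟨K + K - j, by omega⟩
    have h1 := gaussBinom_mul_qFact (z * w) i j
    set F := qFact (z * w)
    set x := bilateralTerm z w K j with hx
    -- The term `x` has degree at least `|j - K|`, and `min i j = K - |j - K|`.
    have hx0 : ∀ n, i < n ∨ j < n → x * (z * w) ^ n = 0 := by
      intro n hn
      rw [hx]
      unfold bilateralTerm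
      split_ifs with hKj
      · rw [mul_assoc, ← pow_add, mul_pow, ← mul_assoc, ← pow_add]
        exact h _ _ (by omega)
      · rw [mul_assoc, ← pow_add, mul_pow, mul_left_comm, ← pow_add]
        exact h _ _ (by omega)
    have hmin : ∃ n, n ≤ i ∧ n ≤ j ∧ n ≤ K ∧ ∀ p, n < p → x * (z * w) ^ p = 0 := by
      refine ⟨min i j, by omega, by omega, by omega, fun p hp => hx0 p (by omega)⟩
    obtain ⟨n, hni, hnj, hnK, hn⟩ := hmin
    have e1 := mul_qFact_eq hni hn
    have e2 := mul_qFact_eq hnj hn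
    have e3 := mul_qFact_eq hnK hn
    have e4 := mul_qFact_eq (i := n) (j := K + K) (by omega) hn
    rw [← hi] at h1
    refine ((isUnit_qFact hQ j).mul (isUnit_qFact hQ i)).mul_right_cancel ?_
    change F K * ((-1) ^ j * gaussBinom (z * w) (K + K) j * x) * (F j * F i) =
      (-1) ^ j * x * (F j * F i)
    linear_combination (-1) ^ j * F K * x * h1 + (-1) ^ j * F K * e4 + (-1) ^ j * F n * e3 -
      (-1) ^ j * F i * e2 - (-1) ^ j * F n * e1
  rw [Finset.sum_congr rfl h0, show K + K + 1 = (K + 1) + K by ring, Finset.sum_range_add,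
    ← Finset.sum_range_reflect _ (K + 1), Finset.sum_range_succ _ K, mul_add, mul_add]
  -- The term of index `-K` vanishes; the others are paired as `-n` and `n + 1`.
  have hz : bilateralTerm z w K (K + 1 - 1 - K) = 0 := by
    unfold bilateralTerm
    rcases Nat.eq_zero_or_pos K with rfl | hK
    · have := h 0 0 le_rfl
      simp only [pow_zero, mul_one] at this
      simp [this]
    · rw [if_neg (by omega), show K - (K + 1 - 1 - K) = K by omega]
      have := h 0 K (by omega)
      rw [pow_zero, one_mul] at this
      rw [this, zero_mul]
  rw [hz, mul_zero, mul_zero, add_zero, Finset.mul_sum, Finset.mul_sum,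
    ← Finset.sum_add_distrib]
  refine Finset.sum_congr rfl fun n hn => ?_
  have hn := Finset.mem_range.1 hn
  have e1 : bilateralTerm z w K (K + 1 - 1 - n) = w ^ n * (z * w) ^ n.choose 2 := by
    unfold bilateralTerm
    rcases n with _ | n
    · simp
    · rw [if_neg (by omega), show K - (K + 1 - 1 - (n + 1)) = n + 1 by omega]
  have e2 : bilateralTerm z w K (K + 1 + n) = z ^ (n + 1) * (z * w) ^ (n + 1).choose 2 := by
    unfold bilateralTerm
    rw [if_pos (by omega), show K + 1 + n - K = n + 1 by omega]
  obtain ⟨m, rfl⟩ : ∃ m, K = m + n := ⟨K - n, by omega⟩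
  rw [e1, e2, show m + n + 1 - 1 - n = m by omega]
  have h1 : (-1 : R) ^ m * (-1) ^ m = 1 := by rw [← mul_pow]; simp
  have h2 : (-1 : R) ^ n * (-1) ^ n = 1 := by rw [← mul_pow]; simp
  have h3 : (-1 : R) ^ (m + n + 1 + n) = -((-1) ^ m * ((-1) ^ n * (-1) ^ n)) := by ring
  rw [h3, pow_add (-1 : R) m n]
  generalize w ^ n * (z * w) ^ n.choose 2 = u
  generalize z ^ (n + 1) * (z * w) ^ (n + 1).choose 2 = v
  generalize (-1 : R) ^ m = s at *
  generalize (-1 : R) ^ n = t at *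
  linear_combination (-t * u + t * v * t * t) * h1 + t * v * h2

/-! ### Product formulas -/

/-- The value of `thetaSeries` at `x = 1` by the triple product with `z = q^a` and `w = q^b`. -/
theorem thetaSeries_eq_prod {K d h e a b : ℕ} (hq : q ^ K = 0) (ha : 0 < a) (hb : 0 < b)
    (hab : 2 * h + d - e = a + b) (hd : 0 < d) :
    thetaSeries q d h e K 0 a = (∏ i ∈ Finset.range K, (1 - q ^ (a + b + (a + b) * i))) *
      ((∏ i ∈ Finset.range K, (1 - q ^ (b + (a + b) * i))) *
        ∏ i ∈ Finset.range K, (1 - q ^ (a + (a + b) * i))) := by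
  have h1 : ∀ i j, K ≤ i + j → (q ^ a) ^ i * (q ^ b) ^ j = 0 := by
    intro i j hij
    rw [← pow_mul, ← pow_mul, ← pow_add]
    refine pow_eq_zero_of_le ?_ hq
    nlinarith
  have h2 := jacobi_triple_product h1
  simp only [qFact, ← pow_add, ← pow_mul] at h2
  have h3 : ∏ i ∈ Finset.range K, (1 - q ^ (a + b + (a + b) * i)) =
      ∏ i ∈ Finset.range K, (1 - q ^ ((a + b) * (i + 1))) :=
    Finset.prod_congr rfl fun i _ => by ring_nf
  rw [h3, ← h2, thetaSeries, hab]
  refine Finset.sum_congr rfl fun n _ => ?_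
  rw [thetaCoeff, qRatio_zero_left hq hd, Nat.add_sub_cancel_left, choose_two_succ]
  ring_nf

/-- The factors of a product over a residue class, among those of the product over all parts. -/
theorem prod_residue {K M c : ℕ} (hc : 0 < c) (hcM : c ≤ M) (φ : ℕ → R)
    (hφ : ∀ i, K ≤ i → φ i = 1) :
    ∏ i ∈ Finset.range K, φ (c + M * i) =
      ∏ i ∈ Finset.range K, if (i + 1) % M = c % M then φ (i + 1) else 1 := by
  refine Finset.prod_bij_ne_one (fun i _ _ => c + M * i - 1) ?_ ?_ ?_ ?_
  · intro i _ hi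
    have : c + M * i < K := by
      by_contra h
      exact hi (hφ _ (by omega))
    exact Finset.mem_range.2 (by omega)
  · intro i _ _ j _ _ hij
    have h1 : M * i = M * j := by omega
    exact Nat.eq_of_mul_eq_mul_left (by omega) h1
  · intro i hi hi'
    have hi := Finset.mem_range.1 hi
    split_ifs at hi' with h
    · have hle : c ≤ i + 1 := by
        rcases hcM.eq_or_lt with rfl | h2
        · rw [Nat.mod_self] at h
          exact Nat.le_of_dvd (Nat.succ_pos i) (Nat.dvd_of_mod_eq_zero h)
        · rw [Nat.mod_eq_of_lt h2] at h
          rw [← h]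
          exact Nat.mod_le _ _
      obtain ⟨j, hj⟩ := (Nat.modEq_iff_dvd' hle).1 (Eq.symm h)
      have hjK : j < K := by
        have : j ≤ M * j := Nat.le_mul_of_pos_left j (by omega)
        omega
      have h4 : c + M * j = i + 1 := by omega
      exact ⟨j, Finset.mem_range.2 hjK, by rwa [h4], by omega⟩
    · exact absurd rfl hi'
  · intro i _ _
    have h1 : c + M * i - 1 + 1 = c + M * i := by omega
    rw [h1, if_pos (by simp)]

/-- The generating function of the overpartitions with non-overlined parts in `α` and overlined
parts in `β`. -/
theorem sum_mul_prod {K B e : ℕ} (hq : q ^ K = 0) (hB : K ≤ B) (hB0 : 0 < B) (he : e ≤ 1)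
    (α β : ℕ → Prop) [DecidablePred α] [DecidablePred β] :
    (∑ n ∈ Finset.range K, (Nat.card {p : Overpartition n // (∀ i, p.freqOver (i + 1) ≤ e) ∧
        ∀ i, ((p.seq i).1 ≠ 0 → α (i + 1)) ∧ ((p.seq i).2 ≠ 0 → β (i + 1))} : R) * q ^ n) *
      ∏ i ∈ Finset.range K, (if α (i + 1) then 1 - q ^ (i + 1) else 1) =
    ∏ i ∈ Finset.range K, (if β (i + 1) then 1 + e * q ^ (i + 1) else 1) := by
  classical
  rw [sum_card_overpartition q he hq hB
    (fun u => ∀ i, ((u i).1 ≠ 0 → α (i + 1)) ∧ ((u i).2 ≠ 0 → β (i + 1)))]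
  have h1 : ∀ g : Fin K → Fin B × Fin (e + 1),
      (if ∀ i, ((extend g i).1 ≠ 0 → α (i + 1)) ∧ ((extend g i).2 ≠ 0 → β (i + 1))
        then q ^ weight 0 g else 0) =
      ∏ i : Fin K, (if (((g i).1 : ℕ) ≠ 0 → α (i + 1)) ∧ (((g i).2 : ℕ) ≠ 0 → β (i + 1))
        then (q ^ ((i : ℕ) + 1)) ^ (((g i).1 : ℕ) + (g i).2) else 0) := by
    intro g
    have h2 : (∀ i, ((extend g i).1 ≠ 0 → α (i + 1)) ∧ ((extend g i).2 ≠ 0 → β (i + 1))) ↔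
        ∀ i : Fin K, (((g i).1 : ℕ) ≠ 0 → α (i + 1)) ∧ (((g i).2 : ℕ) ≠ 0 → β (i + 1)) := by
      constructor
      · intro h i
        simpa [extend] using h i
      · intro h i
        unfold extend
        split_ifs with hi
        · exact h ⟨i, hi⟩
        · simp
    split_ifs with h
    · rw [Finset.prod_congr rfl fun i _ => if_pos (h2.1 h i), weight, ← Finset.prod_pow_eq_pow_sum]
      exact Finset.prod_congr rfl fun i _ => by rw [← pow_mul]; congr 1; ring
    · obtain ⟨i, hi⟩ := not_forall.1 fun H => h (h2.2 H)
      exact (Finset.prod_eq_zero (Finset.mem_univ i) (if_neg hi)).symm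
  have h3 := Finset.prod_univ_sum (fun _ : Fin K => (Finset.univ : Finset (Fin B × Fin (e + 1))))
    (fun i x => if ((x.1 : ℕ) ≠ 0 → α (i + 1)) ∧ ((x.2 : ℕ) ≠ 0 → β (i + 1))
        then (q ^ ((i : ℕ) + 1)) ^ ((x.1 : ℕ) + x.2) else 0)
  rw [Fintype.piFinset_univ] at h3
  rw [Finset.sum_congr rfl fun g _ => h1 g, ← h3, Finset.prod_range, Finset.prod_range,
    ← Finset.prod_mul_distrib]
  refine Finset.prod_congr rfl fun i _ => ?_
  set y := q ^ ((i : ℕ) + 1) with hy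
  have hyB : y ^ B = 0 := by
    rw [hy, ← pow_mul]
    exact pow_eq_zero_of_le (hB.trans (Nat.le_mul_of_pos_left B (Nat.succ_pos _))) hq
  have h4 : (∑ x : Fin B × Fin (e + 1),
      if ((x.1 : ℕ) ≠ 0 → α (i + 1)) ∧ ((x.2 : ℕ) ≠ 0 → β (i + 1))
        then y ^ ((x.1 : ℕ) + x.2) else 0) =
      (∑ j ∈ Finset.range B, if j ≠ 0 → α (i + 1) then y ^ j else 0) *
        ∑ v ∈ Finset.range (e + 1), if v ≠ 0 → β (i + 1) then y ^ v else 0 := by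
    rw [Fintype.sum_prod_type, Finset.sum_range, Finset.sum_range, Finset.sum_mul_sum]
    refine Finset.sum_congr rfl fun j _ => Finset.sum_congr rfl fun v _ => ?_
    rw [pow_add]
    split_ifs <;> simp_all
  have h5 : (∑ j ∈ Finset.range B, if j ≠ 0 → α (i + 1) then y ^ j else 0) *
      (if α (i + 1) then 1 - y else 1) = 1 := by
    by_cases hα : α (i + 1)
    · simp only [hα, implies_true, if_true]
      rw [geom_sum_mul_neg, hyB, sub_zero]
    · simp [hα, hB0.ne']
  have h6 : (∑ v ∈ Finset.range (e + 1), if v ≠ 0 → β (i + 1) then y ^ v else 0) =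
      if β (i + 1) then 1 + e * y else 1 := by
    by_cases hβ : β (i + 1) <;> rcases Nat.le_one_iff_eq_zero_or_eq_one.1 he with rfl | rfl <;>
      simp [hβ, Finset.sum_range_succ]
  rw [h4, h6]
  linear_combination (if β (i + 1) then 1 + e * y else 1) * h5

theorem avoidsResidues_iff {a b : ℕ} (ha : 0 < a) (hb : 0 < b) (i : ℕ) :
    AvoidsResidues (a + b) a i ↔
      i % (a + b) ≠ 0 ∧ i % (a + b) ≠ a ∧ i % (a + b) ≠ b := by
  unfold AvoidsResidues
  have h0 : (i : ℤ) ≡ 0 [ZMOD (a + b : ℕ)] ↔ i % (a + b) = 0 := by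
    have := @Int.natCast_modEq_iff i 0 (a + b)
    rw [Nat.ModEq, Nat.zero_mod] at this
    exact_mod_cast this
  have h1 : (i : ℤ) ≡ (a : ℤ) [ZMOD (a + b : ℕ)] ↔ i % (a + b) = a := by
    rw [Int.natCast_modEq_iff, Nat.ModEq, Nat.mod_eq_of_lt (by omega : a < a + b)]
  have h2 : (i : ℤ) ≡ -(a : ℤ) [ZMOD (a + b : ℕ)] ↔ i % (a + b) = b := by
    have h3 : (b : ℤ) ≡ -(a : ℤ) [ZMOD (a + b : ℕ)] := by
      refine (Int.modEq_iff_dvd.2 ⟨-1, ?_⟩)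
      push_cast
      ring
    have h4 : i % (a + b) = b ↔ (i : ℤ) ≡ (b : ℤ) [ZMOD (a + b : ℕ)] := by
      rw [Int.natCast_modEq_iff, Nat.ModEq, Nat.mod_eq_of_lt (by omega : b < a + b)]
    rw [h4]
    exact ⟨fun h => h.trans h3.symm, fun h => h.trans h3⟩
  rw [h0, h1, h2]

/-- The product over the forbidden parts. -/
theorem thetaSeries_mul_prod_avoids {K d h e a b : ℕ} (hq : q ^ K = 0) (ha : 0 < a) (hb : 0 < b)
    (hne : a ≠ b) (hab : 2 * h + d - e = a + b) (hd : 0 < d)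
    [DecidablePred (AvoidsResidues (a + b) a)] :
    thetaSeries q d h e K 0 a * ∏ i ∈ Finset.range K,
        (if AvoidsResidues (a + b) a (i + 1) then 1 - q ^ (i + 1) else 1) =
      ∏ i ∈ Finset.range K, (1 - q ^ (i + 1)) := by
  have hφ : ∀ i, K ≤ i → 1 - q ^ i = 1 := fun i hi => by
    rw [pow_eq_zero_of_le hi hq, sub_zero]
  rw [thetaSeries_eq_prod hq ha hb hab hd,
    prod_residue (by omega : 0 < a + b) le_rfl (fun i => 1 - q ^ i) hφ,
    prod_residue hb (by omega : b ≤ a + b) (fun i => 1 - q ^ i) hφ,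
    prod_residue ha (by omega : a ≤ a + b) (fun i => 1 - q ^ i) hφ,
    ← Finset.prod_mul_distrib, ← Finset.prod_mul_distrib, ← Finset.prod_mul_distrib]
  refine Finset.prod_congr rfl fun i _ => ?_
  rw [Nat.mod_self, Nat.mod_eq_of_lt (by omega : a < a + b),
    Nat.mod_eq_of_lt (by omega : b < a + b)]
  have h := avoidsResidues_iff ha hb (i + 1)
  by_cases h0 : (i + 1) % (a + b) = 0
  · rw [if_pos h0, if_neg (by omega), if_neg (by omega), if_neg (by rw [h]; omega)]
    ring
  · by_cases h1 : (i + 1) % (a + b) = a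
    · rw [if_neg h0, if_neg (by omega), if_pos h1, if_neg (by rw [h]; omega)]
      ring
    · by_cases h2 : (i + 1) % (a + b) = b
      · rw [if_neg h0, if_pos h2, if_neg h1, if_neg (by rw [h]; omega)]
        ring
      · rw [if_neg h0, if_neg h2, if_neg h1, if_pos (h.2 ⟨h0, h1, h2⟩)]
        ring

theorem prod_even_mul_prod_odd {K : ℕ} {z : R} (hz : z ^ K = 0) :
    (∏ i ∈ Finset.range K, (1 - z ^ (2 + 2 * i))) * ∏ i ∈ Finset.range K, (1 - z ^ (1 + 2 * i)) =
      ∏ i ∈ Finset.range K, (1 - z ^ (i + 1)) := by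
  have hφ : ∀ i, K ≤ i → 1 - z ^ i = 1 := fun i hi => by
    rw [pow_eq_zero_of_le hi hz, sub_zero]
  rw [prod_residue (by omega : 0 < 2) le_rfl (fun i => 1 - z ^ i) hφ,
    prod_residue (by omega : 0 < 1) (by omega : 1 ≤ 2) (fun i => 1 - z ^ i) hφ,
    ← Finset.prod_mul_distrib]
  refine Finset.prod_congr rfl fun i _ => ?_
  rcases Nat.mod_two_eq_zero_or_one (i + 1) with h | h <;> simp [h]

theorem isUnit_prod_one_sub_pow {K : ℕ} (hq : q ^ K = 0) (s : Finset ℕ) {f : ℕ → ℕ}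
    (hf : ∀ i, 0 < f i) :
    IsUnit (∏ i ∈ s, (1 - q ^ f i)) :=
  Finset.prod_induction _ IsUnit (fun _ _ => IsUnit.mul) isUnit_one fun i _ =>
    isUnit_one_sub_pow hq (hf i)

/-- Euler's identity `∏ (1 + zʲ) (1 - z²ʲ⁻¹) = 1`. -/
theorem prod_one_add_mul_prod_odd {K : ℕ} {z : R} (hz : z ^ K = 0) :
    (∏ i ∈ Finset.range K, (1 + z ^ (i + 1))) *
      ∏ i ∈ Finset.range K, (1 - z ^ (1 + 2 * i)) = 1 := by
  have h1 := prod_even_mul_prod_odd hz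
  have h2 : (∏ i ∈ Finset.range K, (1 + z ^ (i + 1))) * ∏ i ∈ Finset.range K, (1 - z ^ (i + 1)) =
      ∏ i ∈ Finset.range K, (1 - z ^ (2 + 2 * i)) := by
    rw [← Finset.prod_mul_distrib]
    exact Finset.prod_congr rfl fun i _ => by ring
  have hu := isUnit_prod_one_sub_pow hz (Finset.range K) (f := fun i => 2 + 2 * i) (by omega)
  refine hu.mul_left_cancel ?_
  linear_combination (∏ i ∈ Finset.range K, (1 + z ^ (i + 1))) * h1 + h2

/-- The product of `thetaSeries` in the symmetric case. -/
theorem thetaSeries_symm {K d h e a : ℕ} (hq : q ^ K = 0) (ha : 0 < a)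
    (hab : 2 * h + d - e = a + a) (hd : 0 < d) :
    thetaSeries q d h e K 0 a * ((∏ i ∈ Finset.range K,
        (if (i + 1) % a = 0 then 1 + q ^ (i + 1) else 1)) * ∏ i ∈ Finset.range K,
        (if (i + 1) % a = 0 then 1 else 1 - q ^ (i + 1))) =
      ∏ i ∈ Finset.range K, (1 - q ^ (i + 1)) := by
  have hz : (q ^ a) ^ K = 0 := by
    rw [← pow_mul]
    exact pow_eq_zero_of_le (Nat.le_mul_of_pos_left K ha) hq
  have h1 := prod_even_mul_prod_odd hz
  have h2 := prod_one_add_mul_prod_odd hz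
  have h3 := prod_residue ha le_rfl (K := K) (fun i => 1 - q ^ i) fun i hi => by
    rw [pow_eq_zero_of_le hi hq, sub_zero]
  have h4 := prod_residue ha le_rfl (K := K) (fun i => 1 + q ^ i) fun i hi => by
    rw [pow_eq_zero_of_le hi hq, add_zero]
  rw [Nat.mod_self] at h3 h4
  have h5 : (∏ i ∈ Finset.range K, (if (i + 1) % a = 0 then 1 - q ^ (i + 1) else 1)) *
      (∏ i ∈ Finset.range K, (if (i + 1) % a = 0 then 1 else 1 - q ^ (i + 1))) =
      ∏ i ∈ Finset.range K, (1 - q ^ (i + 1)) := by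
    rw [← Finset.prod_mul_distrib]
    refine Finset.prod_congr rfl fun i _ => ?_
    split_ifs <;> ring
  have e1 : ∏ i ∈ Finset.range K, (1 - q ^ (a + a + (a + a) * i)) =
      ∏ i ∈ Finset.range K, (1 - (q ^ a) ^ (2 + 2 * i)) :=
    Finset.prod_congr rfl fun i _ => by ring
  have e2 : ∏ i ∈ Finset.range K, (1 - q ^ (a + (a + a) * i)) =
      ∏ i ∈ Finset.range K, (1 - (q ^ a) ^ (1 + 2 * i)) :=
    Finset.prod_congr rfl fun i _ => by ring
  have e3 : ∏ i ∈ Finset.range K, (1 - q ^ (a + a * i)) =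
      ∏ i ∈ Finset.range K, (1 - (q ^ a) ^ (i + 1)) :=
    Finset.prod_congr rfl fun i _ => by ring
  have e4 : ∏ i ∈ Finset.range K, (1 + q ^ (a + a * i)) =
      ∏ i ∈ Finset.range K, (1 + (q ^ a) ^ (i + 1)) :=
    Finset.prod_congr rfl fun i _ => by ring
  rw [thetaSeries_eq_prod hq ha ha hab hd, e1, e2, ← h4, e4, ← h5, ← h3, e3, ← h1]
  set O := ∏ i ∈ Finset.range K, (1 - (q ^ a) ^ (1 + 2 * i))
  set E := ∏ i ∈ Finset.range K, (1 - (q ^ a) ^ (2 + 2 * i))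
  linear_combination E * O * (∏ i ∈ Finset.range K,
    (if (i + 1) % a = 0 then 1 else 1 - q ^ (i + 1))) * h2

/-! ### The generating functions of the counters -/

open Classical in
theorem sum_countA {K d k a b : ℕ} (hq : q ^ K = 0) (hM : 2 * k + 2 - d = a + b) :
    (∑ n ∈ Finset.range K, (countA d k a n : R) * q ^ n) * ∏ i ∈ Finset.range K,
      (if AvoidsResidues (a + b) a (i + 1) then 1 - q ^ (i + 1) else 1) = 1 := by
  have h := sum_mul_prod hq (Nat.le_succ K) (Nat.succ_pos K) (Nat.zero_le 1)
    (AvoidsResidues (a + b) a) (fun _ => True)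
  simp only [Nat.cast_zero, zero_mul, add_zero, ite_self, Finset.prod_const_one] at h
  refine Eq.trans ?_ h
  congr 1
  refine Finset.sum_congr rfl fun n _ => ?_
  congr 2
  have h1 := card_partition (n := n) fun f => ∀ i, f i ≠ 0 → AvoidsResidues (a + b) a (i + 1)
  simp only [implies_true, and_true]
  rw [← h1, countA, hM]
  refine Nat.card_congr (Equiv.subtypeEquivRight fun p => ?_)
  constructor
  · intro H i hi
    exact H _ (Multiset.count_ne_zero.1 hi)
  · intro H i hi
    obtain ⟨j, rfl⟩ : ∃ j, i = j + 1 := ⟨i - 1, by have := p.parts_pos hi; omega⟩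
    exact H j (Multiset.count_ne_zero.2 hi)

theorem Overpartition.forall_plain_iff {n : ℕ} (p : Overpartition n) (α : ℕ → Prop) :
    (∀ i ∈ p.plain, α i) ↔ ∀ i, (p.seq i).1 ≠ 0 → α (i + 1) := by
  constructor
  · intro H i hi
    exact H _ (Multiset.count_ne_zero.1 hi)
  · intro H i hi
    obtain ⟨j, rfl⟩ : ∃ j, i = j + 1 := ⟨i - 1, by have := p.plain_pos i hi; omega⟩
    exact H j (Multiset.count_ne_zero.2 hi)

theorem Overpartition.forall_overlined_iff {n : ℕ} (p : Overpartition n) (β : ℕ → Prop) :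
    (∀ i ∈ p.overlined, β i) ↔ ∀ i, (p.seq i).2 ≠ 0 → β (i + 1) := by
  constructor
  · intro H i hi
    refine H _ ?_
    by_contra h
    exact hi (if_neg h)
  · intro H i hi
    obtain ⟨j, rfl⟩ : ∃ j, i = j + 1 := ⟨i - 1, by have := p.overlined_pos i hi; omega⟩
    refine H j ?_
    change (if j + 1 ∈ p.overlined then 1 else 0) ≠ 0
    rw [if_pos hi]
    exact one_ne_zero

theorem Overpartition.freqOver_le {n : ℕ} (p : Overpartition n) (i : ℕ) : p.freqOver i ≤ 1 := by
  unfold Overpartition.freqOver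
  split_ifs <;> omega

open Classical in
theorem sum_countAOver {K d k a b : ℕ} (hq : q ^ K = 0) (hM : 2 * k + 1 - d = a + b)
    (hab : a ≠ b) :
    (∑ n ∈ Finset.range K, (countAOver d k a n : R) * q ^ n) * ∏ i ∈ Finset.range K,
      (if AvoidsResidues (a + b) a (i + 1) then 1 - q ^ (i + 1) else 1) =
      ∏ i ∈ Finset.range K, (1 + q ^ (i + 1)) := by
  have h := sum_mul_prod hq (Nat.le_succ K) (Nat.succ_pos K) (le_refl 1)
    (AvoidsResidues (a + b) a) (fun _ => True)
  simp only [Nat.cast_one, one_mul, if_true] at h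
  refine Eq.trans ?_ h
  congr 1
  refine Finset.sum_congr rfl fun n _ => ?_
  congr 2
  rw [countAOver, if_neg (by omega), hM]
  refine Nat.card_congr (Equiv.subtypeEquivRight fun p => ?_)
  rw [p.forall_plain_iff]
  simp [p.freqOver_le]

theorem sum_countAOver_symm {K d k a : ℕ} (hq : q ^ K = 0) (hM : 2 * k + 1 - d = a + a) :
    (∑ n ∈ Finset.range K, (countAOver d k a n : R) * q ^ n) * ∏ i ∈ Finset.range K,
      (if (i + 1) % a = 0 then 1 else 1 - q ^ (i + 1)) =
      ∏ i ∈ Finset.range K, (if (i + 1) % a = 0 then 1 else 1 + q ^ (i + 1)) := by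
  have h := sum_mul_prod hq (Nat.le_succ K) (Nat.succ_pos K) (le_refl 1)
    (fun i => ¬ i % a = 0) (fun i => ¬ i % a = 0)
  have h1 : ∀ x : ℕ → R, (∏ i ∈ Finset.range K, if (i + 1) % a = 0 then 1 else x i) =
      ∏ i ∈ Finset.range K, if ¬ (i + 1) % a = 0 then x i else 1 := fun x =>
    Finset.prod_congr rfl fun i _ => by split_ifs <;> rfl
  simp only [Nat.cast_one, one_mul] at h
  rw [h1, h1]
  refine Eq.trans ?_ h
  congr 1
  refine Finset.sum_congr rfl fun n _ => ?_
  congr 2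
  rw [countAOver, if_pos (by omega), hM, show (a + a) / 2 = a by omega]
  refine Nat.card_congr (Equiv.subtypeEquivRight fun p => ?_)
  rw [p.forall_plain_iff, p.forall_overlined_iff]
  simp only [p.freqOver_le, implies_true, true_and, forall_and, Nat.ModEq, Nat.zero_mod]

theorem admSeries_eq_countA {K d k a : ℕ} (hq : q ^ K = 0) (hK : 0 < K) (hd : 0 < d)
    (hdk : d ≤ k) (ha : 0 < a) (hak : a ≤ k + 1) (hda : d ∣ 2 * a) (hdk' : d ∣ 2 * (k + 1))
    (hne : 2 * a ≠ 2 * k + 2 - d) :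
    admSeries q d k 0 K 0 a (a - 1) = ∑ n ∈ Finset.range K, (countA d k a n : R) * q ^ n := by
  classical
  obtain ⟨h, hh⟩ : ∃ h, h + d = k + 1 := ⟨k + 1 - d, by omega⟩
  obtain ⟨b, hb⟩ : ∃ b, 2 * k + 2 - d = a + b := ⟨2 * k + 2 - d - a, by omega⟩
  have h1 := admSeries_mul_prod hq hK hd (Nat.zero_le 1) (by omega : 1 ≤ h) hh hdk' (by simp) K 0
    (zero_add K) a (by omega) hda
  have h2 := thetaSeries_mul_prod_avoids (h := h) (e := 0) (b := b) hq ha (by omega) (by omega)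
    (by omega) hd
  have h3 := sum_countA hq hb
  simp only [zero_add, Nat.cast_zero, zero_mul, add_zero, Finset.prod_const_one, one_mul] at h1
  have hu := isUnit_prod_one_sub_pow hq (Finset.range K) (f := fun i => i + 1) (by omega)
  refine hu.mul_right_cancel ?_
  rw [h1, ← h2]
  linear_combination -thetaSeries q d h 0 K 0 a * h3

theorem admSeries_eq_countAOver {K d k a : ℕ} (hq : q ^ K = 0) (hK : 0 < K) (hd : d = 1 ∨ d = 2)
    (hk : 2 ≤ k) (ha : 0 < a) (hak : a ≤ k) :
    admSeries q d k 1 K 0 a (a - 1) = ∑ n ∈ Finset.range K, (countAOver d k a n : R) * q ^ n := by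
  classical
  obtain ⟨h, hh⟩ : ∃ h, h + d = k + 1 := ⟨k + 1 - d, by omega⟩
  obtain ⟨b, hb⟩ : ∃ b, 2 * k + 1 - d = a + b := ⟨2 * k + 1 - d - a, by omega⟩
  have hd2 : ∀ x, d ∣ 2 * x := by
    intro x
    rcases hd with rfl | rfl
    · exact one_dvd _
    · exact dvd_mul_right _ _
  have h1 := admSeries_mul_prod hq hK (by omega) (le_refl 1) (by omega : 1 ≤ h) hh (hd2 _) (hd2 _)
    K 0 (zero_add K) a (by omega) (hd2 _)
  simp only [zero_add, Nat.cast_one, one_mul] at h1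
  have hu := isUnit_prod_one_sub_pow hq (Finset.range K) (f := fun i => i + 1) (by omega)
  refine hu.mul_right_cancel ?_
  rw [h1]
  by_cases hab : a = b
  · subst hab
    have h2 := thetaSeries_symm (h := h) (e := 1) hq ha (by omega) (by omega : 0 < d)
    have h3 := sum_countAOver_symm hq hb
    have h4 : (∏ i ∈ Finset.range K, (if (i + 1) % a = 0 then 1 + q ^ (i + 1) else 1)) *
        (∏ i ∈ Finset.range K, (if (i + 1) % a = 0 then 1 else 1 + q ^ (i + 1))) =
        ∏ i ∈ Finset.range K, (1 + q ^ (i + 1)) := by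
      rw [← Finset.prod_mul_distrib]
      refine Finset.prod_congr rfl fun i _ => ?_
      split_ifs <;> ring
    rw [← h2, ← h4]
    linear_combination -thetaSeries q d h 1 K 0 a *
      (∏ i ∈ Finset.range K, (if (i + 1) % a = 0 then 1 + q ^ (i + 1) else 1)) * h3
  · have h2 := thetaSeries_mul_prod_avoids (h := h) (e := 1) (b := b) hq ha (by omega) hab
      (by omega) (by omega : 0 < d)
    have h3 := sum_countAOver hq hb hab
    rw [← h2]
    linear_combination -thetaSeries q d h 1 K 0 a * h3

theorem admSeries_eq_countBOver {K d s k a : ℕ} (hq : q ^ K = 0) (hd : 0 < d) (hdk : d ≤ k)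
    (hak : a ≤ k) :
    admSeries q d k 1 K 0 a (a + s - 1) =
      ∑ n ∈ Finset.range K, (countBOver d s k a n : R) * q ^ n := by
  rw [← sum_admissible_eq_admSeries q hd hdk (B := K + k) (by omega) K 0 a _ (by omega),
    ← sum_card_overpartition q (le_refl 1) hq (by omega) (Admissible d k a (a + s - 1))]
  refine Finset.sum_congr rfl fun n _ => ?_
  congr 2
  refine Nat.card_congr (Equiv.subtypeEquivRight fun p => ?_)
  simp [condBOver_iff hd, p.freqOver_le]

theorem condB_iff {d s k a n : ℕ} (hd : 0 < d) (p : n.Partition) :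
    CondB d s k a p ↔ Admissible d k a ((a : ℤ) + s - 1) fun i => (freq p (i + 1), 0) := by
  unfold CondB Admissible
  refine and_congr Iff.rfl ?_
  have hrho : ∀ i, seqRho (fun i => (freq p (i + 1), 0)) i = 0 := by
    intro i
    simp [seqRho]
  have hodd : ∀ i, freqOdd p (i + 1) = seqOdd (fun i => (freq p (i + 1), 0)) i := by
    intro i
    unfold freqOdd seqOdd
    simp only [Nat.odd_add_one, Nat.not_odd_iff_even, add_zero]
  simp only [hrho, sub_zero, add_zero, ← hodd]
  constructor
  · intro h i
    exact (residue_condition_iff hd _ _).1 (h (i + 1) (by omega))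
  · intro h i hi
    obtain ⟨i, rfl⟩ : ∃ j, i = j + 1 := ⟨i - 1, by omega⟩
    exact (residue_condition_iff hd _ _).2 (h i)

theorem admSeries_eq_countB {K d s k a : ℕ} (hq : q ^ K = 0) (hd : 0 < d) (hdk : d ≤ k)
    (hak : a ≤ k) :
    admSeries q d k 0 K 0 a (a + s - 1) =
      ∑ n ∈ Finset.range K, (countB d s k a n : R) * q ^ n := by
  rw [← sum_admissible_eq_admSeries q hd hdk (B := K + k) (by omega) K 0 a _ (by omega),
    ← sum_card_overpartition q (Nat.zero_le 1) hq (by omega) (Admissible d k a (a + s - 1))]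
  refine Finset.sum_congr rfl fun n _ => ?_
  congr 2
  have h := card_partition (n := n)
    fun f => Admissible d k a ((a : ℤ) + s - 1) fun i => (f i, 0)
  rw [countB]
  simp only [condB_iff hd]
  rw [h]
  refine Nat.card_congr (Equiv.subtypeEquivRight fun p => and_congr_right fun hp => ?_)
  have : p.seq = fun i => ((p.seq i).1, 0) := by
    funext i
    exact Prod.ext rfl (Nat.le_zero.1 (hp i))
  rw [← this]

/-! ### Relations between the counting series -/

/-- The relation for `s ≠ 0` when `a + s ≥ d`. -/
theorem admSeries_shift {K d k e a s : ℕ} (hq : q ^ K = 0) (hK : 0 < K) (hs : s ≤ d)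
    (hb : d ≤ a + s) :
    (1 - q ^ d) * admSeries q d k e K 0 a (a + s - 1) =
      (1 - q ^ (d - s)) * admSeries q d k e K 0 (a + s) ((a + s : ℕ) - 1) +
      (q ^ (d - s) - q ^ d) * admSeries q d k e K 0 (a + s - d) ((a + s - d : ℕ) - 1) := by
  obtain ⟨L, rfl⟩ : ∃ L, K = L + 1 := ⟨K - 1, by omega⟩
  obtain ⟨t, ht⟩ : ∃ t, a + s = t + d := ⟨a + s - d, by omega⟩
  have h1 := admSeries_sub q (d := d) (k := k) (e := e) L 0 (a₁ := t) (a₂ := a) (b := a + s)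
    (by omega) (by omega) (by omega)
  have h2 := admSeries_sub q (d := d) (k := k) (e := e) L 0 (a₁ := t) (a₂ := a + s) (b := a + s)
    (by omega) (by omega) le_rfl
  have h3 : admSeries q d k e (L + 1) 0 t (((a + s : ℕ) : ℤ) - 1) =
      admSeries q d k e (L + 1) 0 t ((t : ℤ) - 1) := by
    refine admSeries_congr q _ _ _ ?_
    refine (Int.ModEq.sub_right 1 ?_)
    rw [ht]
    push_cast
    exact Int.add_modEq_right
  have e1 : a + s - d = t := by omega
  have e2 : ((a : ℤ) + s - 1) = ((a + s : ℕ) : ℤ) - 1 := by push_cast; ring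
  rw [h3] at h1 h2
  rw [e1, e2]
  have hu := isUnit_one_sub_pow hq (i := 0 + 1) (by omega)
  refine hu.mul_left_cancel ?_
  obtain ⟨r, rfl⟩ : ∃ r, d = r + s := ⟨d - s, by omega⟩
  obtain rfl : a = t + r := by omega
  rw [Nat.add_sub_cancel]
  linear_combination (1 - q ^ (r + s)) * h1 - (1 - q ^ r) * h2

/-- The relation for `s ≠ 0` when `d = 2 (a + s)`. -/
theorem admSeries_shift_half {K d k e a s : ℕ} (hq : q ^ K = 0) (hK : 0 < K) (ha : 0 < a)
    (hd : d = 2 * (a + s)) :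
    (1 - q ^ (a + s)) * admSeries q d k e K 0 a (a + s - 1) =
      (1 - q ^ a) * admSeries q d k e K 0 (a + s) ((a + s : ℕ) - 1) := by
  obtain ⟨L, rfl⟩ : ∃ L, K = L + 1 := ⟨K - 1, by omega⟩
  have h1 := admSeries_sub q (d := d) (k := k) (e := e) L 0 (a₁ := 0) (a₂ := a) (b := a + s)
    (by omega) (by omega) (by omega)
  have h2 := admSeries_sub q (d := d) (k := k) (e := e) L 0 (a₁ := 0) (a₂ := a + s) (b := a + s)
    (by omega) (by omega) le_rfl
  rw [admSeries_zero, sub_zero] at h1 h2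
  have e2 : ((a : ℤ) + s - 1) = ((a + s : ℕ) : ℤ) - 1 := by push_cast; ring
  rw [e2]
  have hu := isUnit_one_sub_pow hq (i := 0 + 1) (by omega)
  refine hu.mul_left_cancel ?_
  linear_combination (1 - q ^ (a + s)) * h1 - (1 - q ^ a) * h2

/-! ### Extraction of coefficients -/

open PowerSeries in
theorem sum_eq_mk (K : ℕ) (F : ℕ → ℕ) :
    ∑ n ∈ Finset.range K, (F n : ℤ⟦X⟧ ⧸ Ideal.span {(X : ℤ⟦X⟧) ^ K}) *
      Ideal.Quotient.mk (Ideal.span {(X : ℤ⟦X⟧) ^ K}) X ^ n =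
      Ideal.Quotient.mk _ (PowerSeries.mk fun n => (F n : ℤ)) := by
  have h : ∑ n ∈ Finset.range K, (F n : ℤ⟦X⟧ ⧸ Ideal.span {(X : ℤ⟦X⟧) ^ K}) *
      Ideal.Quotient.mk (Ideal.span {(X : ℤ⟦X⟧) ^ K}) X ^ n =
      Ideal.Quotient.mk _ (∑ n ∈ Finset.range K, (F n : ℤ⟦X⟧) * X ^ n) := by
    simp
  rw [h, Ideal.Quotient.eq, Ideal.mem_span_singleton, X_pow_dvd_iff]
  intro m hm
  have h1 : ∀ n, coeff m ((F n : ℤ⟦X⟧) * X ^ n) = if m = n then (F n : ℤ) else 0 := by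
    intro n
    rw [← map_natCast (C (R := ℤ)), coeff_C_mul, coeff_X_pow]
    simp
  simp [h1, hm]

open PowerSeries in
/-- Multiplication by `X ^ t` shifts the argument, with the value `0` at negative arguments. -/
theorem atInt_sub (F : ℕ → ℕ) (n t : ℕ) :
    atInt F ((n : ℤ) - t) = coeff n ((X : ℤ⟦X⟧) ^ t * PowerSeries.mk fun n => (F n : ℤ)) := by
  rw [coeff_X_pow_mul', atInt]
  by_cases h : t ≤ n
  · rw [if_pos (by omega), if_pos h, coeff_mk]
    congr 2
    omega
  · rw [if_neg (by omega), if_neg h]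

/-- A linear relation between generating functions, valid in all rings with a nilpotent element
`q`, holds for the coefficients. -/
theorem atInt_relation {ι : Type*} (s : Finset ι) (c : ι → ℤ) (t : ι → ℕ) (F : ι → ℕ → ℕ) (n : ℕ)
    (h : ∀ {R : Type} [CommRing R] (q : R) (K : ℕ), q ^ K = 0 → 0 < K →
      ∑ i ∈ s, (c i : R) * (q ^ t i * ∑ m ∈ Finset.range K, (F i m : R) * q ^ m) = 0) :
    ∑ i ∈ s, c i * atInt (F i) ((n : ℤ) - t i) = 0 := by
  set I := Ideal.span {(PowerSeries.X : PowerSeries ℤ) ^ (n + 1)} with hI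
  have h1 := h (Ideal.Quotient.mk I PowerSeries.X) (n + 1)
    (by rw [← map_pow, Ideal.Quotient.eq_zero_iff_mem]; exact Ideal.mem_span_singleton_self _)
    (Nat.succ_pos n)
  rw [Finset.sum_congr rfl fun i _ => congrArg (fun x => (c i : PowerSeries ℤ ⧸ I) *
    (Ideal.Quotient.mk I PowerSeries.X ^ t i * x)) (sum_eq_mk (n + 1) (F i))] at h1
  have h2 : Ideal.Quotient.mk I (∑ i ∈ s, (c i : PowerSeries ℤ) *
      (PowerSeries.X ^ t i * PowerSeries.mk fun n => (F i n : ℤ))) = 0 := by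
    rw [← h1]
    simp
    rfl
  rw [Ideal.Quotient.eq_zero_iff_mem, Ideal.mem_span_singleton, PowerSeries.X_pow_dvd_iff] at h2
  have h3 := h2 n (Nat.lt_succ_self n)
  rw [map_sum] at h3
  rw [← h3]
  refine Finset.sum_congr rfl fun i _ => ?_
  rw [atInt_sub, ← map_intCast (PowerSeries.C (R := ℤ)), PowerSeries.coeff_C_mul]
  rfl

theorem atInt_natCast (F : ℕ → ℕ) (n : ℕ) : atInt F n = F n := by
  simp [atInt]

theorem eq_of_sum_eq {F G : ℕ → ℕ} (n : ℕ)
    (h : ∀ {R : Type} [CommRing R] (q : R) (K : ℕ), q ^ K = 0 → 0 < K →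
      ∑ m ∈ Finset.range K, (F m : R) * q ^ m = ∑ m ∈ Finset.range K, (G m : R) * q ^ m) :
    F n = G n := by
  have h1 := atInt_relation Finset.univ ![1, -1] ![0, 0] ![F, G] n (by
    intro R _ q K hq hK
    simp [Fin.sum_univ_succ, h q K hq hK])
  simp [Fin.sum_univ_succ, atInt_natCast] at h1
  omega

end GordonModD

theorem theorem3p5 (k a d s : ℕ) (hk : 2 ≤ k) (ha : 1 ≤ a) (hak : a ≤ k) (hd : 1 ≤ d) (hdk : d ≤ k)
    (hs : s ≤ d - 1) (n : ℕ) :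
    -- the case `s = 0`, partitions
    (s = 0 → 2 * a ≡ 0 [MOD d] → 2 * (k + 1) ≡ 0 [MOD d] → 2 * a ≠ 2 * k + 2 - d →
      GordonModD.countA d k a n = GordonModD.countB d 0 k a n) ∧
    -- the case `s = 0`, overpartitions
    (s = 0 → (d = 1 ∨ d = 2) →
      GordonModD.countAOver d k a n = GordonModD.countBOver d 0 k a n) ∧
    -- the case `s ≠ 0`, partitions
    (s ≠ 0 → 2 * (a + s) ≡ 0 [MOD d] → 2 * (k + 1) ≡ 0 [MOD d] →
      2 * (a + s) ≠ 2 * k + 2 - d → 2 * (a + s) ≠ 2 * k + 2 + d →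
      (d < a + s →
        GordonModD.atInt (GordonModD.countA d k (a + s)) n
          - GordonModD.atInt (GordonModD.countA d k (a + s)) (n - (d - s))
          + GordonModD.atInt (GordonModD.countA d k (a + s - d)) (n - (d - s))
          - GordonModD.atInt (GordonModD.countA d k (a + s - d)) (n - d)
        = GordonModD.atInt (GordonModD.countB d s k a) n
          - GordonModD.atInt (GordonModD.countB d s k a) (n - d)) ∧
      (d = a + s →
        GordonModD.atInt (GordonModD.countA d k (a + s)) n
          - GordonModD.atInt (GordonModD.countA d k (a + s)) (n - (d - s))
        = GordonModD.atInt (GordonModD.countB d s k a) n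
          - GordonModD.atInt (GordonModD.countB d s k a) (n - d)) ∧
      (a + s < d →
        GordonModD.atInt (GordonModD.countA d k (a + s)) n
          - GordonModD.atInt (GordonModD.countA d k (a + s)) (n - (d - s))
          + GordonModD.atInt (GordonModD.countA d k (d - a - s)) (n - (a + s))
          - GordonModD.atInt (GordonModD.countA d k (d - a - s)) (n - a)
        = GordonModD.atInt (GordonModD.countB d s k a) n
          - GordonModD.atInt (GordonModD.countB d s k a) (n - d))) ∧
    -- the case `s ≠ 0`, overpartitions
    (s ≠ 0 → (d = 1 ∨ d = 2) → a + s ≤ k →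
      (d < a + s →
        GordonModD.atInt (GordonModD.countAOver d k (a + s)) n
          - GordonModD.atInt (GordonModD.countAOver d k (a + s)) (n - (d - s))
          + GordonModD.atInt (GordonModD.countAOver d k (a + s - d)) (n - (d - s))
          - GordonModD.atInt (GordonModD.countAOver d k (a + s - d)) (n - d)
        = GordonModD.atInt (GordonModD.countBOver d s k a) n
          - GordonModD.atInt (GordonModD.countBOver d s k a) (n - d)) ∧
      (d = a + s →
        GordonModD.atInt (GordonModD.countAOver d k (a + s)) n
          - GordonModD.atInt (GordonModD.countAOver d k (a + s)) (n - (d - s))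
        = GordonModD.atInt (GordonModD.countBOver d s k a) n
          - GordonModD.atInt (GordonModD.countBOver d s k a) (n - d))) := by
  open GordonModD in
  have hds : ((d - s : ℕ) : ℤ) = (d : ℤ) - s := by omega
  refine ⟨?_, ?_, ?_, ?_⟩
  · rintro rfl h2a h2k hne
    refine eq_of_sum_eq n fun q K hq hK => ?_
    rw [← admSeries_eq_countA hq hK hd hdk ha (by omega) ((Nat.modEq_zero_iff_dvd).1 h2a)
      ((Nat.modEq_zero_iff_dvd).1 h2k) hne, ← admSeries_eq_countB hq hd hdk hak]
    simp
  · rintro rfl hd12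
    refine eq_of_sum_eq n fun q K hq hK => ?_
    rw [← admSeries_eq_countAOver hq hK hd12 hk ha hak, ← admSeries_eq_countBOver hq hd hdk hak]
    simp
  · intro hs0 h2a h2k hne hne'
    rw [Nat.modEq_zero_iff_dvd] at h2a h2k
    -- With `2 (a + s) = d x` and `2 (k + 1) = d y`, `s < d` gives `x < y + 2`, and `x = y + 1` is
    -- the excluded case `2 (a + s) = 2 k + 2 + d`.
    have hb : a + s ≤ k + 1 := by
      obtain ⟨x, hx⟩ := h2a
      obtain ⟨y, hy⟩ := h2k
      have h1 : x < y + 2 := by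
        by_contra h
        have : d * (y + 2) ≤ d * x := Nat.mul_le_mul_left d (by omega)
        rw [mul_add] at this
        omega
      have h2 : x ≠ y + 1 := by
        rintro rfl
        rw [mul_add d] at hx
        omega
      have : d * x ≤ d * y := Nat.mul_le_mul_left d (by omega)
      omega
    refine ⟨fun hda => ?_, fun hda => ?_, fun hda => ?_⟩
    · have h1 := atInt_relation Finset.univ ![1, -1, 1, -1, -1, 1] ![0, d - s, d - s, d, 0, d]
        ![countA d k (a + s), countA d k (a + s), countA d k (a + s - d), countA d k (a + s - d),
          countB d s k a, countB d s k a] n (by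
        intro R _ q K hq hK
        have h1 := admSeries_shift (k := k) (e := 0) hq hK (by omega : s ≤ d) hda.le
        rw [admSeries_eq_countA hq hK hd hdk (by omega) hb h2a h2k hne,
          admSeries_eq_countA hq hK hd hdk (by omega) (by omega)
            (by rw [Nat.mul_sub]; exact Nat.dvd_sub h2a (dvd_mul_left d 2)) h2k (by omega),
          admSeries_eq_countB hq hd hdk hak] at h1
        simp [Fin.sum_univ_succ]
        linear_combination -h1)
      simp [Fin.sum_univ_succ, hds] at h1
      linear_combination h1
    · have h1 := atInt_relation Finset.univ ![1, -1, -1, 1] ![0, d - s, 0, d]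
        ![countA d k (a + s), countA d k (a + s), countB d s k a, countB d s k a] n (by
        intro R _ q K hq hK
        have h1 := admSeries_shift (k := k) (e := 0) hq hK (by omega : s ≤ d) hda.le
        rw [admSeries_eq_countA hq hK hd hdk (by omega) hb h2a h2k hne,
          show a + s - d = 0 by omega, admSeries_zero, mul_zero, add_zero,
          admSeries_eq_countB hq hd hdk hak] at h1
        simp [Fin.sum_univ_succ]
        linear_combination -h1)
      simp [Fin.sum_univ_succ, hds] at h1
      linear_combination h1
    · -- `d ∣ 2 (a + s)` and `0 < a + s < d`; in particular `d - a - s = a + s`.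
      have hd2 : d = 2 * (a + s) := by
        obtain ⟨c, hc⟩ := h2a
        have hc1 : c < 2 := by
          by_contra h
          have : d * 2 ≤ d * c := Nat.mul_le_mul_left d (by omega)
          omega
        interval_cases c <;> omega
      have e1 : d - a - s = a + s := by omega
      rw [e1]
      have h1 := atInt_relation Finset.univ ![1, -1, 1, -1, -1, 1] ![0, d - s, a + s, a, 0, d]
        ![countA d k (a + s), countA d k (a + s), countA d k (a + s), countA d k (a + s),
          countB d s k a, countB d s k a] n (by
        intro R _ q K hq hK
        have h1 := admSeries_shift_half (k := k) (e := 0) hq hK ha hd2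
        rw [admSeries_eq_countA hq hK hd hdk (by omega) hb h2a h2k hne,
          admSeries_eq_countB hq hd hdk hak] at h1
        have e2 : d - s = a + (a + s) := by omega
        have e3 : q ^ d = q ^ (a + s) * q ^ (a + s) := by rw [← pow_add, hd2, two_mul]
        simp [Fin.sum_univ_succ, e2, e3]
        linear_combination -(1 + q ^ (a + s)) * h1)
      simp [Fin.sum_univ_succ, hds] at h1
      linear_combination h1
  · intro hs0 hd12 hb
    refine ⟨fun hda => ?_, fun hda => ?_⟩
    · have h1 := atInt_relation Finset.univ ![1, -1, 1, -1, -1, 1] ![0, d - s, d - s, d, 0, d]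
        ![countAOver d k (a + s), countAOver d k (a + s), countAOver d k (a + s - d),
          countAOver d k (a + s - d), countBOver d s k a, countBOver d s k a] n (by
        intro R _ q K hq hK
        have h1 := admSeries_shift (k := k) (e := 1) hq hK (by omega : s ≤ d) hda.le
        rw [admSeries_eq_countAOver hq hK hd12 hk (by omega) hb,
          admSeries_eq_countAOver hq hK hd12 hk (by omega) (by omega),
          admSeries_eq_countBOver hq hd hdk hak] at h1
        simp [Fin.sum_univ_succ]
        linear_combination -h1)
      simp [Fin.sum_univ_succ, hds] at h1
      linear_combination h1
    · have h1 := atInt_relation Finset.univ ![1, -1, -1, 1] ![0, d - s, 0, d]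
        ![countAOver d k (a + s), countAOver d k (a + s), countBOver d s k a,
          countBOver d s k a] n (by
        intro R _ q K hq hK
        have h1 := admSeries_shift (k := k) (e := 1) hq hK (by omega : s ≤ d) hda.le
        rw [admSeries_eq_countAOver hq hK hd12 hk (by omega) hb,
          show a + s - d = 0 by omega, admSeries_zero, mul_zero, add_zero,
          admSeries_eq_countBOver hq hd hdk hak] at h1
        simp [Fin.sum_univ_succ]
        linear_combination -h1)
      simp [Fin.sum_univ_succ, hds] at h1
      linear_combination h1
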